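/- **System DR.** Roles are $R ::= \mathsf{Nom}\mid\mathsf{Rep}$, ordered by $\mathsf{Nom}\le\mathsf{Rep}$, with minimum $\wedge$; relevance flags are $\rho ::= +\mid -$; flags of term arguments are $\nu ::= R\mid\rho$; flags are $\upsilon ::= \nu\mid\bullet$. With term variables $x$, coercion variables $c$ and constants $F$, the terms and types, propositions, contexts, patterns and signatures are (up to renaming of bound variables) $$a,b,A,B ::= \star\mid x\mid F\mid\lambda^\rho x.b\mid a\,b^\nu\mid\Box\mid\Pi^\rho x{:}A\to B\mid\Lambda c.a\mid a\,\bullet\mid\forall c{:}\phi.A\mid\mathsf{case}\ a\ \mathsf{of}\ F\,\overline\upsilon\to b_1\,\|\,\_\to b_2,\qquad \phi ::= a\sim_R b:A,$$ $$\Gamma ::= \varnothing\mid\Gamma,x{:}A\mid\Gamma,c{:}\phi,\qquad p ::= F\mid p\,x^R\mid p\,x^+\mid p\,\Box^-\mid p\,\bullet,\qquad \Sigma ::= \varnothing\mid\Sigma\cup\{F:A\,@\,\overline R\}\mid\Sigma\cup\{F:A\,@\,\overline R\ \mathsf{where}\ p\sim_R a\}.$$ The variables of $p$ are distinct and bound in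 $a$. Coercion variables do not occur in terms. Fix a signature $\Sigma$; $\widetilde\Gamma$ is the set of variables declared in $\Gamma$, and $\Delta$ is a finite set of coercion variables. Variables added to a context are fresh. *Auxiliary relations.* $\mathsf{Roles}(F)=\overline R$ if $F:A\,@\,\overline R$ is declared (with or without axiom); if $\mathsf{Roles}(a)=R,\overline R$ then $\mathsf{Roles}(a\,b^R)=\mathsf{Roles}(a\,b^+)=\overline R$; and $\mathsf{Roles}(a\,b^-)=\mathsf{Roles}(a\,\bullet)=\mathsf{Roles}(a)$. A path headed by $F$ is a declared constant $F$ applied to any arguments. A path matches $p$ if it has the head and the flags of $p$. $\mathsf{CasePath}_R\,a=F$ means: $a$ is a path headed by $F$, and $F$ has no axiom, or has an axiom $p\sim_{R_1}b$ with $R_1\not\le R$, or has an axiom whose pattern matches no prefix of $a$. The values at role $R$ are $\star$, $\Pi$- and $\forall$-types, $\lambda^+x.b$, $\Lambda c.a$, $\lambda^-x.b$ with $b$ a value at $R$, and all $a$ with $\mathsf{CasePath}_R\,a=F$ for some $F$. $a\leftrightarrow F\,\overline\upsilon$ means that $a$ is $F$ applied to arguments with flags $\overline\upsilon$, where $F$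 has no axiom or only one at role $\mathsf{Rep}$. $\mathsf{SatApp}\,F\,\overline\upsilon$ means that the role list declared for $F$ is obtained from $\overline\upsilon$ by replacing $+$ by $\mathsf{Nom}$ and deleting $-$ and $\bullet$. Primitive reduction $\vDash a\to^\beta_R b$ is given by - $(\lambda^\rho x.v)\,b^\rho\to^\beta_R v\{b/x\}$ if $\lambda^\rho x.v$ is a value at $R$; $(\Lambda c.a)\,\bullet\to^\beta_R a$; - $a\to^\beta_R b\{\overline a/\overline x\}$ if $F$ has an axiom $p\sim_{R_1}b$ with $R_1\le R$, and $a$ matches $p$ with arguments $\overline a$ for its variables $\overline x$; - $(\mathsf{case}\ a\ \mathsf{of}\ F\,\overline\upsilon\to b_1\|\_\to b_2)\to^\beta_R b_1'\,\bullet$ if $a\leftrightarrow F\,\overline\upsilon$, where $b_1'$ is $b_1$ applied to the arguments of $a$ (flags that are roles being replaced by $+$); it reduces to $b_2$ if $a$ is a value at $\mathsf{Nom}$ and $a\leftrightarrow F\,\overline\upsilon$ fails. $\mathsf{Branch}(a{:}A;\,b{:}B;\,\overline\upsilon;\,D;\,C)$, where $D$ is the type of a branch: for $\overline\upsilon$ empty,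 $D=\forall c{:}(a\sim_{\mathsf{Nom}}b:A).C$; for $\overline\upsilon=\nu,\overline\upsilon'$ with $\nu\in\{R,+\}$, $B=\Pi^+x{:}A'\to B'$, $D=\Pi^+x{:}A'\to D'$ and $\mathsf{Branch}(a{:}A;\,b\,x^\nu{:}B';\,\overline\upsilon';\,D';\,C)$; for $\overline\upsilon=-,\overline\upsilon'$ likewise with $\Pi^-$ and $b\,\Box^-$; for $\overline\upsilon=\bullet,\overline\upsilon'$ likewise with $\forall c{:}\phi$ and $b\,\bullet$. *The judgments* $\vDash\Gamma$, $\Gamma\vDash a:A$, $\Gamma\vDash\phi\ \mathsf{ok}$, $\Gamma;\Delta\vDash\phi_1\equiv\phi_2$ and $\Gamma;\Delta\vDash a\equiv_R b:A$ are the least relations closed under the following rules. Contexts: $\vDash\varnothing$; $\vDash\Gamma,x{:}A$ if $\vDash\Gamma$ and $\Gamma\vDash A:\star$; $\vDash\Gamma,c{:}\phi$ if $\vDash\Gamma$ and $\Gamma\vDash\phi\ \mathsf{ok}$. Propositions: $\Gamma\vDash(a\sim_Rb:A)\ \mathsf{ok}$ if $\Gamma\vDash a:A$, $\Gamma\vDash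 b:A$, $\Gamma\vDash A:\star$. Typing: - $\Gamma\vDash\star:\star$ if $\vDash\Gamma$; $\Gamma\vDash x:A$ if $\vDash\Gamma$ and $x{:}A\in\Gamma$; $\Gamma\vDash F:A$ if $\vDash\Gamma$, $F$ is declared in $\Sigma$ with type $A$ (with or without axiom), and $\varnothing\vDash A:\star$; - $\Gamma\vDash\Pi^\rho x{:}A\to B:\star$ if $\Gamma,x{:}A\vDash B:\star$ and $\Gamma\vDash A:\star$; - $\Gamma\vDash\lambda^\rho x.a:\Pi^\rho x{:}A\to B$ if $\Gamma,x{:}A\vDash a:B$, $\Gamma\vDash A:\star$, and, when $\rho=-$, $x$ is not free in $a$; - if $\Gamma\vDash b:\Pi^+x{:}A\to B$ and $\Gamma\vDash a:A$, then $\Gamma\vDash b\,a^+:B\{a/x\}$, and $\Gamma\vDash b\,a^R:B\{a/x\}$ provided $\mathsf{Roles}(b)=R,\overline R$ for some $\overline R$; - if $\Gamma\vDash b:\Pi^-x{:}A\to B$ and $\Gamma\vDash a:A$, then $\Gamma\vDash b\,\Box^-:B\{a/x\}$; - $\Gamma\vDash a:B$ if $\Gamma\vDash a:A$, $\Gamma;\widetilde\Gamma\vDash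 A\equiv_{\mathsf{Rep}}B:\star$ and $\Gamma\vDash B:\star$; - if $\Gamma\vDash\phi\ \mathsf{ok}$: $\Gamma\vDash\forall c{:}\phi.B:\star$ when $\Gamma,c{:}\phi\vDash B:\star$, and $\Gamma\vDash\Lambda c.a:\forall c{:}\phi.B$ when $\Gamma,c{:}\phi\vDash a:B$; - $\Gamma\vDash a_1\,\bullet:B$ if $\Gamma\vDash a_1:\forall c{:}(a\sim_Rb:A).B$ and $\Gamma;\widetilde\Gamma\vDash a\equiv_Rb:A$; - $\Gamma\vDash(\mathsf{case}\ a\ \mathsf{of}\ F\,\overline\upsilon\to b_1\|\_\to b_2):C$ if $\Gamma\vDash a:A$, $\Gamma\vDash F:A_1$, $\Gamma\vDash b_1:B$, $\Gamma\vDash b_2:C$, $\mathsf{Branch}(a{:}A;\,F{:}A_1;\,\overline\upsilon;\,B;\,C)$ and $\mathsf{SatApp}\,F\,\overline\upsilon$. Equality of propositions: - $\Gamma;\Delta\vDash(a_1\sim_Rb_1:A)\equiv(a_2\sim_Rb_2:A)$ if $\Gamma;\Delta\vDash a_1\equiv_Ra_2:A$ and $\Gamma;\Delta\vDash b_1\equiv_Rb_2:A$;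 - $\Gamma;\Delta\vDash(a\sim_Rb:A)\equiv(a\sim_Rb:B)$ if $\Gamma;\Delta\vDash A\equiv_{\mathsf{Rep}}B:\star$ and both propositions are $\mathsf{ok}$ in $\Gamma$; - $\Gamma;\Delta\vDash\phi_1\equiv\phi_2$ if $\Gamma;\Delta\vDash\forall c{:}\phi_1.B_1\equiv_R\forall c{:}\phi_2.B_2:\star$ for some $B_1,B_2,R$. Definitional equality ($\equiv_R$ is in $\Gamma;\Delta$ unless another context is shown): - $a\equiv_Rb:A$ if $\vDash\Gamma$ and $c{:}(a\sim_Rb:A)\in\Gamma$ with $c\in\Delta$; $a\equiv_Ra:A$ if $\Gamma\vDash a:A$; symmetry; transitivity; $a\equiv_{R_2}b:A$ if $a\equiv_{R_1}b:A$ and $R_1\le R_2$; $a_1\equiv_Ra_2:B$ if $\Gamma\vDash a_1:B$, $\Gamma\vDash a_2:B$ and $\vDash a_1\to^\beta_Ra_2$; - $\Pi^\rho x{:}A_1\to B_1\equiv_R\Pi^\rho x{:}A_2\to B_2:\star$ if $A_1\equiv_RA_2:\star$, $\Gamma,x{:}A_1;\Delta\vDash B_1\equiv_RB_2:\star$, and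 $A_1$ and both $\Pi$-types have type $\star$ in $\Gamma$; - $\lambda^\rho x.b_1\equiv_R\lambda^\rho x.b_2:\Pi^\rho x{:}A\to B$ if $\Gamma,x{:}A;\Delta\vDash b_1\equiv_Rb_2:B$, $\Gamma\vDash A:\star$, and, when $\rho=-$, $x$ is not free in $b_1,b_2$; - $a_1\,a_2^+\equiv_Rb_1\,b_2^+:B\{a_2/x\}$ if $a_1\equiv_Rb_1:\Pi^+x{:}A\to B$ and $a_2\equiv_{\mathsf{Nom}}b_2:A$; - $a_1\,a_2^R\equiv_{R'}b_1\,b_2^R:B\{a_2/x\}$ if $a_1\equiv_{R'}b_1:\Pi^+x{:}A\to B$, $a_2\equiv_{R\wedge R'}b_2:A$, $\mathsf{Roles}(a_1)=\mathsf{Roles}(b_1)=R,\overline R$ for some $\overline R$, and $\Gamma\vDash b_1\,b_2^R:B\{a_2/x\}$; - $a_1\,\Box^-\equiv_Rb_1\,\Box^-:B\{a/x\}$ if $a_1\equiv_Rb_1:\Pi^-x{:}A\to B$ and $\Gamma\vDash a:A$; - if $\Pi^\rho x{:}A_1\to B_1\equiv_R\Pi^\rho x{:}A_2\to B_2:\star$,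 then $A_1\equiv_RA_2:\star$, and $B_1\{a_1/x\}\equiv_RB_2\{a_2/x\}:\star$ whenever $a_1\equiv_{\mathsf{Nom}}a_2:A_1$; - $\forall c{:}\phi_1.B_1\equiv_R\forall c{:}\phi_2.B_2:\star$ if $\Gamma;\Delta\vDash\phi_1\equiv\phi_2$, $\Gamma,c{:}\phi_1;\Delta\vDash B_1\equiv_RB_2:\star$, $\Gamma\vDash\phi_1\ \mathsf{ok}$, and both $\forall$-types have type $\star$ in $\Gamma$; - $\Lambda c.a_1\equiv_R\Lambda c.a_2:\forall c{:}\phi.B$ if $\Gamma,c{:}\phi;\Delta\vDash a_1\equiv_Ra_2:B$ and $\Gamma\vDash\phi\ \mathsf{ok}$; - $a_1\,\bullet\equiv_{R'}b_1\,\bullet:B$ if $a_1\equiv_{R'}b_1:\forall c{:}(a\sim_Rb:A).B$ and $\Gamma;\widetilde\Gamma\vDash a\equiv_Rb:A$; - $B_1\equiv_{R}B_2:\star$ if $\forall c{:}(a_1\sim_{R_1}b_1:A_1).B_1\equiv_R\forall c{:}(a_2\sim_{R_2}b_2:A_2).B_2:\star$ and $\Gamma;\widetilde\Gamma\vDash a_i\equiv_{R_i}b_i:A_i$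 for $i=1,2$; - if $\Gamma;\Delta\vDash(a\sim_Rb:A)\equiv(a'\sim_{R'}b':A')$, then $A\equiv_{\mathsf{Rep}}A':\star$, and $a'\equiv_{R'}b':A'$ whenever $a\equiv_Rb:A$; $\ a\equiv_Rb:B$ if $a\equiv_Rb:A$ and $\Gamma;\widetilde\Gamma\vDash A\equiv_{\mathsf{Rep}}B:\star$; - $(\mathsf{case}\ a\ \mathsf{of}\ F\,\overline\upsilon\to b_1\|\_\to b_2)\equiv_R(\mathsf{case}\ a'\ \mathsf{of}\ F\,\overline\upsilon\to b_1'\|\_\to b_2'):C$ if $a\equiv_{\mathsf{Nom}}a':A$, $b_1\equiv_Rb_1':B$, $b_2\equiv_Rb_2':C$, $\Gamma\vDash F:A_1$, $\mathsf{Branch}(a{:}A;F{:}A_1;\overline\upsilon;B;C)$, $\mathsf{Branch}(a'{:}A;F{:}A_1;\overline\upsilon;B';C)$, $\Gamma;\widetilde\Gamma\vDash B\equiv_{\mathsf{Rep}}B':\star$ and $\mathsf{SatApp}\,F\,\overline\upsilon$; - if $a\,b^{R_1}\equiv_Ra'\,b'^{R_1}:B\{b/x\}$, $\mathsf{CasePath}_R$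 maps both sides to the same $F$, $a,a'$ have type $\Pi^+x{:}A\to B$ and $b,b'$ have type $A$ in $\Gamma$, and $\Gamma;\widetilde\Gamma\vDash B\{b/x\}\equiv_{\mathsf{Rep}}B\{b'/x\}:\star$, then $a\equiv_Ra':\Pi^+x{:}A\to B$ and $b\equiv_{R_1\wedge R}b':A$; if $a\,\Box^-\equiv_Ra'\,\Box^-:B\{b/x\}$ under the same conditions with $\Pi^-$, then $a\equiv_Ra':\Pi^-x{:}A\to B$; if $a\,\bullet\equiv_Ra'\,\bullet:B$, $\mathsf{CasePath}_R$ maps both sides to the same $F$, $a,a'$ have type $\forall c{:}(a_1\sim_{R_1}a_2:A).B$ in $\Gamma$ and $\Gamma;\widetilde\Gamma\vDash a_1\equiv_{R_1}a_2:A$, then $a\equiv_Ra':\forall c{:}(a_1\sim_{R_1}a_2:A).B$. *Well-formed signatures.* Let $\Omega$ assign roles to variables. Role-checking $\Omega\vDash a:R$: always for $\star,\Box,F$; for $x$ if $\Omega(x)\le R$; for $\lambda^\rho x.b$ if $\Omega,x{:}\mathsf{Nom}\vDash b:R$; for $a\,b^\rho$ if $\Omega\vDash a:R$ and $\Omega\vDash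 b:\mathsf{Nom}$; for $a\,b^{R_1}$ if $\Omega\vDash a:R$ and $\Omega\vDash b:R_1\wedge R$; for $\Pi^\rho x{:}A\to B$ if $\Omega\vDash A:R$ and $\Omega,x{:}\mathsf{Nom}\vDash B:R$; for $\Lambda c.a$ and $a\,\bullet$ if $\Omega\vDash a:R$; for $\forall c{:}(a\sim_{R_1}b:A).B$ if $\Omega\vDash a:R_1$, $\Omega\vDash b:R_1$, $\Omega\vDash A:R_0$ for some $R_0$, and $\Omega\vDash B:R$; for a case expression if its scrutinee role-checks at $\mathsf{Nom}$ and its branches at $R$. $\mathsf{PatCtx}(p,F{:}A)=\Gamma;B;\Omega$ decomposes the type $A$ along a pattern $p$ headed by $F$: $\mathsf{PatCtx}(F,F{:}A)=\varnothing;A;\varnothing$, and if $\mathsf{PatCtx}(p,F{:}A)=\Gamma;B';\Omega$ then, for $B'=\Pi^+x{:}A'\to B$, $\mathsf{PatCtx}(p\,x^R,F{:}A)=\Gamma,x{:}A';B;\Omega,x{:}R$ and $\mathsf{PatCtx}(p\,x^+,F{:}A)=\Gamma,x{:}A';B;\Omega,x{:}\mathsf{Nom}$; for $B'=\Pi^-x{:}A'\to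 B$, $\mathsf{PatCtx}(p\,\Box^-,F{:}A)=\Gamma,x{:}A';B;\Omega$; for $B'=\forall c{:}\phi.B$, $\mathsf{PatCtx}(p\,\bullet,F{:}A)=\Gamma,c{:}\phi;B;\Omega$. The signature $\Sigma$ is well-formed, $\vDash\Sigma$, if no constant is declared twice, $\varnothing\vDash A:\star$ for the type $A$ of each declared constant, and for each declaration $F:A\,@\,\overline R\ \mathsf{where}\ p\sim_Ra$ there are $\Gamma,B,\Omega$ with $\mathsf{PatCtx}(p,F{:}A)=\Gamma;B;\Omega$, $\Gamma\vDash a:B$, $\Omega\vDash a:R$, and $\overline R$ the list of roles in $\Omega$. (All judgments are with respect to the whole of $\Sigma$, so declarations may be mutually recursive.) **Lemma (Typing Regularity).** Let $\Sigma$ be a signature with $\vDash\Sigma$. For every context $\Gamma$ and all terms $a$, $A$ of System DR over $\Sigma$: if $\Gamma\vDash a:A$, then $\Gamma\vDash A:\star$. -/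

import Mathlib

/-!
System DR: a dependently typed lambda calculus with `star : star`, irrelevant arguments, coercion
abstraction, case analysis, and a definitional equality indexed by roles.

Binding is represented by de Bruijn indices.  Term variables and coercion variables are counted
separately.  Coercion variables never occur inside terms (a coercion argument is always written
as the elided coercion), so only term variables are shifted or substituted.
-/

namespace SystemDR

/-! ## Roles and flags -/

/-- Roles: nominal (bottom) and representational (top). -/
inductive Role
  | nom
  | rep

/-- The order on roles, with bottom `nom` and top `rep`. -/
def Role.Sub : Role → Role → Prop
  | .rep, .nom => False
  | _, _ => True

/-- The minimum of two roles. -/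
def Role.min : Role → Role → Role
  | .rep, .rep => .rep
  | _, _ => .nom

/-- Relevance flags `+` and `-`. -/
inductive Rel
  | plus
  | minus

/-- Application flags for term arguments: a role, or a relevance flag. -/
inductive TmFlag
  | role (R : Role)
  | rho (r : Rel)

/-- Application flags for arbitrary arguments: those for term arguments, or a coercion mark. -/
inductive Flag
  | tm (v : TmFlag)
  | co

/-- Names of constants. -/
abbrev Const := ℕ

/-! ## Terms -/

/-- Terms and types.
`lam r b` and `pi r A B` bind one term variable, in `b` and in `B`.
`app a v b` is the application of `a` to `b` with flag `v`; `box` is the trivial term.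
`clam a` is coercion abstraction, `capp a` is application to the elided coercion, and
`all a b A R B` is the type of functions from proofs of the proposition `a ~ b : A` at role `R`
to `B`.
`caseOf a F us b₁ b₂` is the case expression with scrutinee `a`, nameless pattern `F us`,
branch `b₁` and default branch `b₂`. -/
inductive Tm
  | star
  | var (n : ℕ)
  | const (F : Const)
  | lam (r : Rel) (b : Tm)
  | app (a : Tm) (v : TmFlag) (b : Tm)
  | box
  | pi (r : Rel) (A B : Tm)
  | clam (a : Tm)
  | capp (a : Tm)
  | all (a b A : Tm) (R : Role) (B : Tm)
  | caseOf (a : Tm) (F : Const) (us : List Flag) (b₁ b₂ : Tm)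

/-- Extension of a renaming under a binder. -/
def upRen (f : ℕ → ℕ) : ℕ → ℕ
  | 0 => 0
  | n + 1 => f n + 1

/-- Renaming of term variables. -/
def Tm.rename : (ℕ → ℕ) → Tm → Tm
  | _, .star => .star
  | f, .var n => .var (f n)
  | _, .const F => .const F
  | f, .lam r b => .lam r (b.rename (upRen f))
  | f, .app a v b => .app (a.rename f) v (b.rename f)
  | _, .box => .box
  | f, .pi r A B => .pi r (A.rename f) (B.rename (upRen f))
  | f, .clam a => .clam (a.rename f)
  | f, .capp a => .capp (a.rename f)
  | f, .all a b A R B => .all (a.rename f) (b.rename f) (A.rename f) R (B.rename f)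
  | f, .caseOf a F us b₁ b₂ => .caseOf (a.rename f) F us (b₁.rename f) (b₂.rename f)

/-- Weakening by one term variable. -/
def Tm.shift (a : Tm) : Tm := a.rename Nat.succ

/-- Extension of a substitution under a binder. -/
def upSub (s : ℕ → Tm) : ℕ → Tm
  | 0 => .var 0
  | n + 1 => (s n).shift

/-- Simultaneous (capture-avoiding) substitution for term variables. -/
def Tm.subst : (ℕ → Tm) → Tm → Tm
  | _, .star => .star
  | s, .var n => s n
  | _, .const F => .const F
  | s, .lam r b => .lam r (b.subst (upSub s))
  | s, .app a v b => .app (a.subst s) v (b.subst s)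
  | _, .box => .box
  | s, .pi r A B => .pi r (A.subst s) (B.subst (upSub s))
  | s, .clam a => .clam (a.subst s)
  | s, .capp a => .capp (a.subst s)
  | s, .all a b A R B => .all (a.subst s) (b.subst s) (A.subst s) R (B.subst s)
  | s, .caseOf a F us b₁ b₂ => .caseOf (a.subst s) F us (b₁.subst s) (b₂.subst s)

/-- The substitution of `a` for the variable `0`, lowering all other variables. -/
def single (a : Tm) : ℕ → Tm
  | 0 => a
  | n + 1 => .var n

/-- `B.inst a` is `B{a/x}`, where `x` is the variable `0`. -/
def Tm.inst (B a : Tm) : Tm := B.subst (single a)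

/-- The term variable `n` occurs free in a term. -/
def Tm.Free : ℕ → Tm → Prop
  | _, .star => False
  | n, .var m => m = n
  | _, .const _ => False
  | n, .lam _ b => b.Free (n + 1)
  | n, .app a _ b => a.Free n ∨ b.Free n
  | _, .box => False
  | n, .pi _ A B => A.Free n ∨ B.Free (n + 1)
  | n, .clam a => a.Free n
  | n, .capp a => a.Free n
  | n, .all a b A _ B => a.Free n ∨ b.Free n ∨ A.Free n ∨ B.Free n
  | n, .caseOf a _ _ b₁ b₂ => a.Free n ∨ b₁.Free n ∨ b₂.Free n

/-- The bound variable of an irrelevant abstraction with body `b` must not occur in `b`. -/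
def RhoCheck (r : Rel) (b : Tm) : Prop :=
  match r with
  | .plus => True
  | .minus => ¬ b.Free 0

/-- Equality propositions `lhs ~ rhs : ty` at role `role`. -/
structure EqProp where
  lhs : Tm
  rhs : Tm
  ty : Tm
  role : Role

/-- Weakening of propositions by one term variable. -/
def EqProp.shift (φ : EqProp) : EqProp :=
  ⟨φ.lhs.shift, φ.rhs.shift, φ.ty.shift, φ.role⟩

/-! ## Contexts -/

/-- Context entries: a term variable with its type, or a coercion variable with its proposition. -/
inductive Entry
  | tm (A : Tm)
  | co (φ : EqProp)

/-- Contexts; the most recent entry comes first. -/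
abbrev Ctx := List Entry

/-- `HasTm Γ n A`: the term variable `n` has type `A` in `Γ`. -/
inductive HasTm : Ctx → ℕ → Tm → Prop
  | here {Γ A} : HasTm (.tm A :: Γ) 0 A.shift
  | skipTm {Γ n A B} : HasTm Γ n A → HasTm (.tm B :: Γ) (n + 1) A.shift
  | skipCo {Γ n A φ} : HasTm Γ n A → HasTm (.co φ :: Γ) n A

/-- `HasCo Γ c φ`: the coercion variable `c` has proposition `φ` in `Γ`. -/
inductive HasCo : Ctx → ℕ → EqProp → Prop
  | here {Γ φ} : HasCo (.co φ :: Γ) 0 φ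
  | skipTm {Γ c φ B} : HasCo Γ c φ → HasCo (.tm B :: Γ) c φ.shift
  | skipCo {Γ c φ ψ} : HasCo Γ c φ → HasCo (.co ψ :: Γ) (c + 1) φ

/-- The number of coercion variables of a context. -/
def numCo : Ctx → ℕ
  | [] => 0
  | .tm _ :: Γ => numCo Γ
  | .co _ :: Γ => numCo Γ + 1

/-- The set of all coercion variables of a context. -/
def coDom (Γ : Ctx) : Finset ℕ := Finset.range (numCo Γ)

/-- A set of coercion variables of `Γ`, seen in the extension of `Γ` by one new coercion variable
(which is not in the set). -/
def shiftCo (Δ : Finset ℕ) : Finset ℕ := Δ.image Nat.succ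

/-! ## Signatures -/

/-- Patterns of axioms: a constant applied to distinct variables (flagged with a role or with `+`),
to trivial irrelevant arguments, and to elided coercions.  Each term argument of the pattern
stands for one variable; the last one has index `0`. -/
inductive Pat
  | const (F : Const)
  | appRole (p : Pat) (R : Role)
  | appPlus (p : Pat)
  | appIrr (p : Pat)
  | capp (p : Pat)

/-- Declarations of a constant: an opaque constant with its type `A` and the roles `Rs` of its
parameters; or a constant that moreover has an axiom equating the pattern `p` with the term `a` at
role `R`, where the variables of the pattern are bound in `a`. -/
inductive Decl
  | opq (A : Tm) (Rs : List Role)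
  | ax (A : Tm) (Rs : List Role) (p : Pat) (R : Role) (a : Tm)

/-- Signatures. -/
abbrev Sig := List (Const × Decl)

/-! ## Paths, values and primitive reduction -/

/-- `Roles S a Rs`: the roles of the remaining parameters of the path `a` are `Rs`. -/
inductive Roles (S : Sig) : Tm → List Role → Prop
  | opq {F A Rs} : (F, Decl.opq A Rs) ∈ S → Roles S (.const F) Rs
  | ax {F A Rs p R a} : (F, Decl.ax A Rs p R a) ∈ S → Roles S (.const F) Rs
  | tapp {a b R Rs} : Roles S a (R :: Rs) → Roles S (.app a (.role R) b) Rs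
  | app {a b R Rs} : Roles S a (R :: Rs) → Roles S (.app a (.rho .plus) b) Rs
  | iapp {a b Rs} : Roles S a Rs → Roles S (.app a (.rho .minus) b) Rs
  | capp {a Rs} : Roles S a Rs → Roles S (.capp a) Rs

/-- `Head S a F`: the term `a` is a path headed by the declared constant `F`. -/
inductive Head (S : Sig) : Tm → Const → Prop
  | opq {F A Rs} : (F, Decl.opq A Rs) ∈ S → Head S (.const F) F
  | ax {F A Rs p R a} : (F, Decl.ax A Rs p R a) ∈ S → Head S (.const F) F
  | app {a v b F} : Head S a F → Head S (.app a v b) F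
  | capp {a F} : Head S a F → Head S (.capp a) F

/-- `Match a p as`: the term `a` matches the pattern `p`, and `as` lists the terms that are
matched with the variables of `p`, the last one first. -/
inductive Match : Tm → Pat → List Tm → Prop
  | const {F} : Match (.const F) (.const F) []
  | appRole {a p l R b} : Match a p l → Match (.app a (.role R) b) (.appRole p R) (b :: l)
  | appPlus {a p l b} : Match a p l → Match (.app a (.rho .plus) b) (.appPlus p) (b :: l)
  | appIrr {a p l b} : Match a p l → Match (.app a (.rho .minus) b) (.appIrr p) (.box :: l)
  | capp {a p l} : Match a p l → Match (.capp a) (.capp p) l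

/-- `MatchSubst a p b b'`: the term `a` matches the pattern `p`, and `b'` arises from `b` by
substituting the matched arguments for the variables of the pattern. -/
def MatchSubst (a : Tm) (p : Pat) (b b' : Tm) : Prop :=
  ∃ l : List Tm, Match a p l ∧ b' = b.subst (fun n => l.getD n .box)

/-- Some prefix of the path `a` matches the pattern `p`. -/
inductive PrefixMatch : Tm → Pat → Prop
  | base {a p l} : Match a p l → PrefixMatch a p
  | app {a v b p} : PrefixMatch a p → PrefixMatch (.app a v b) p
  | capp {a p} : PrefixMatch a p → PrefixMatch (.capp a) p

/-- `CasePath S R a F`: the term `a` is a path headed by `F` that cannot reduce at role `R`. -/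
inductive CasePath (S : Sig) (R : Role) : Tm → Const → Prop
  | opq {a F A Rs} : Head S a F → (F, Decl.opq A Rs) ∈ S → CasePath S R a F
  | ax {a F A Rs p R₁ b} : Head S a F → (F, Decl.ax A Rs p R₁ b) ∈ S → ¬ R₁.Sub R →
      CasePath S R a F
  | unmatch {a F A Rs p R₁ b} : Head S a F → (F, Decl.ax A Rs p R₁ b) ∈ S →
      ¬ PrefixMatch a p → CasePath S R a F

/-- Values at role `R`. -/
inductive Value (S : Sig) (R : Role) : Tm → Prop
  | star : Value S R .star
  | pi {r A B} : Value S R (.pi r A B)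
  | all {a b A R₁ B} : Value S R (.all a b A R₁ B)
  | lamRel {b} : Value S R (.lam .plus b)
  | lamIrr {b} : Value S R b → Value S R (.lam .minus b)
  | clam {a} : Value S R (.clam a)
  | path {a F} : CasePath S R a F → Value S R a

/-- `AppsPath S R a F us`: the term `a` is headed by `F`, which is a constant at role `R` (opaque,
or with an axiom that is not available at role `R`), and its arguments have the flags `us`. -/
inductive AppsPath (S : Sig) (R : Role) : Tm → Const → List Flag → Prop
  | opq {F A Rs} : (F, Decl.opq A Rs) ∈ S → AppsPath S R (.const F) F []
  | ax {F A Rs p R₁ b} : (F, Decl.ax A Rs p R₁ b) ∈ S → ¬ R₁.Sub R →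
      AppsPath S R (.const F) F []
  | app {a v b F us} : AppsPath S R a F us → AppsPath S R (.app a v b) F (us ++ [.tm v])
  | capp {a F us} : AppsPath S R a F us → AppsPath S R (.capp a) F (us ++ [.co])

/-- `ApplyArgs a b b'`: `b'` is `b` applied to the arguments of the path `a`; a role-annotated
argument is passed with flag `+`. -/
inductive ApplyArgs : Tm → Tm → Tm → Prop
  | const {F b} : ApplyArgs (.const F) b b
  | appRole {a b b' R c} : ApplyArgs a b b' →
      ApplyArgs (.app a (.role R) c) b (.app b' (.rho .plus) c)
  | appRho {a b b' r c} : ApplyArgs a b b' →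
      ApplyArgs (.app a (.rho r) c) b (.app b' (.rho r) c)
  | capp {a b b'} : ApplyArgs a b b' → ApplyArgs (.capp a) b (.capp b')

/-- The list of roles that a list of application flags stands for. -/
def appRoles : List Flag → List Role
  | [] => []
  | .tm (.role R) :: us => R :: appRoles us
  | .tm (.rho .plus) :: us => .nom :: appRoles us
  | .tm (.rho .minus) :: us => appRoles us
  | .co :: us => appRoles us

/-- The flags `us` saturate the constant `F`. -/
inductive SatApp (S : Sig) (F : Const) (us : List Flag) : Prop
  | opq {A Rs} : (F, Decl.opq A Rs) ∈ S → appRoles us = Rs → SatApp S F us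
  | ax {A Rs p R a} : (F, Decl.ax A Rs p R a) ∈ S → appRoles us = Rs → SatApp S F us

/-- Primitive reduction at a role. -/
inductive Beta (S : Sig) : Tm → Tm → Role → Prop
  | appAbs {r v b R} : Value S R (.lam r v) →
      Beta S (.app (.lam r v) (.rho r) b) (v.inst b) R
  | cappCabs {a R} : Beta S (.capp (.clam a)) a R
  | ax {F A Rs p R₁ b a b' R} : (F, Decl.ax A Rs p R₁ b) ∈ S → MatchSubst a p b b' →
      R₁.Sub R → Beta S a b' R
  | patTrue {a F us b₁ b₂ b₁' R} : AppsPath S .nom a F us → ApplyArgs a b₁ b₁' →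
      Beta S (.caseOf a F us b₁ b₂) (.capp b₁') R
  | patFalse {a F us b₁ b₂ R} : Value S .nom a → ¬ AppsPath S .nom a F us →
      Beta S (.caseOf a F us b₁ b₂) b₂ R

/-! ## Typing and definitional equality -/

/-- `BranchTyping a A b B us D C`: in a case expression with result type `C` and scrutinee `a : A`,
`D` is the type of the branch for the pattern that applies `b : B` to further arguments with flags
`us`.  The branch abstracts over these arguments and over a proof that the scrutinee is nominally
equal to the pattern. -/
inductive BranchTyping : Tm → Tm → Tm → Tm → List Flag → Tm → Tm → Prop
  | base {a A b B C} : BranchTyping a A b B [] (.all a b A .nom C) C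
  | piRole {a A b A' B us D C R} :
      BranchTyping a.shift A.shift (.app b.shift (.role R) (.var 0)) B us D C.shift →
      BranchTyping a A b (.pi .plus A' B) (.tm (.role R) :: us) (.pi .plus A' D) C
  | piRel {a A b A' B us D C} :
      BranchTyping a.shift A.shift (.app b.shift (.rho .plus) (.var 0)) B us D C.shift →
      BranchTyping a A b (.pi .plus A' B) (.tm (.rho .plus) :: us) (.pi .plus A' D) C
  | piIrr {a A b A' B us D C} :
      BranchTyping a.shift A.shift (.app b.shift (.rho .minus) .box) B us D C.shift →
      BranchTyping a A b (.pi .minus A' B) (.tm (.rho .minus) :: us) (.pi .minus A' D) C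
  | all {a A b a₁ a₂ A' R B us D C} :
      BranchTyping a A (.capp b) B us D C →
      BranchTyping a A b (.all a₁ a₂ A' R B) (.co :: us) (.all a₁ a₂ A' R D) C

mutual

/-- Typing: `Typing S Γ a A` is `Γ ⊨ a : A`. -/
inductive Typing (S : Sig) : Ctx → Tm → Tm → Prop
  | star {Γ} : CtxOk S Γ → Typing S Γ .star .star
  | var {Γ x A} : CtxOk S Γ → HasTm Γ x A → Typing S Γ (.var x) A
  | pi {Γ r A B} :
      Typing S (.tm A :: Γ) B .star →
      Typing S Γ A .star →
      Typing S Γ (.pi r A B) .star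
  | abs {Γ r a A B} :
      Typing S (.tm A :: Γ) a B →
      Typing S Γ A .star →
      RhoCheck r a →
      Typing S Γ (.lam r a) (.pi r A B)
  | app {Γ b a A B} :
      Typing S Γ b (.pi .plus A B) →
      Typing S Γ a A →
      Typing S Γ (.app b (.rho .plus) a) (B.inst a)
  | tapp {Γ b a A B R Rs} :
      Typing S Γ b (.pi .plus A B) →
      Typing S Γ a A →
      Roles S b (R :: Rs) →
      Typing S Γ (.app b (.role R) a) (B.inst a)
  | iapp {Γ b a A B} :
      Typing S Γ b (.pi .minus A B) →
      Typing S Γ a A →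
      Typing S Γ (.app b (.rho .minus) .box) (B.inst a)
  | conv {Γ a A B} :
      Typing S Γ a A →
      DefEq S Γ (coDom Γ) A B .star .rep →
      Typing S Γ B .star →
      Typing S Γ a B
  | cpi {Γ a b A R B} :
      Typing S (.co ⟨a, b, A, R⟩ :: Γ) B .star →
      PropWff S Γ ⟨a, b, A, R⟩ →
      Typing S Γ (.all a b A R B) .star
  | cabs {Γ a₀ a b A R B} :
      Typing S (.co ⟨a, b, A, R⟩ :: Γ) a₀ B →
      PropWff S Γ ⟨a, b, A, R⟩ →
      Typing S Γ (.clam a₀) (.all a b A R B)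
  | capp {Γ a₀ a b A R B} :
      Typing S Γ a₀ (.all a b A R B) →
      DefEq S Γ (coDom Γ) a b A R →
      Typing S Γ (.capp a₀) B
  | const {Γ F A Rs} :
      CtxOk S Γ →
      (F, Decl.opq A Rs) ∈ S →
      Typing S [] A .star →
      Typing S Γ (.const F) A
  | fam {Γ F A Rs p R a} :
      CtxOk S Γ →
      (F, Decl.ax A Rs p R a) ∈ S →
      Typing S [] A .star →
      Typing S Γ (.const F) A
  | caseOf {Γ a A F us b₁ b₂ A₁ B C} :
      Typing S Γ a A →
      Typing S Γ (.const F) A₁ →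
      Typing S Γ b₁ B →
      Typing S Γ b₂ C →
      BranchTyping a A (.const F) A₁ us B C →
      SatApp S F us →
      Typing S Γ (.caseOf a F us b₁ b₂) C

/-- Well-formed propositions. -/
inductive PropWff (S : Sig) : Ctx → EqProp → Prop
  | wff {Γ a b A R} :
      Typing S Γ a A →
      Typing S Γ b A →
      Typing S Γ A .star →
      PropWff S Γ ⟨a, b, A, R⟩

/-- Definitional equality of propositions: `Iso S Γ Δ φ₁ φ₂` is `Γ; Δ ⊨ φ₁ ≡ φ₂`. -/
inductive Iso (S : Sig) : Ctx → Finset ℕ → EqProp → EqProp → Prop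
  | propCong {Γ Δ a₁ a₂ b₁ b₂ A R} :
      DefEq S Γ Δ a₁ a₂ A R →
      DefEq S Γ Δ b₁ b₂ A R →
      Iso S Γ Δ ⟨a₁, b₁, A, R⟩ ⟨a₂, b₂, A, R⟩
  | isoConv {Γ Δ a b A B R} :
      DefEq S Γ Δ A B .star .rep →
      PropWff S Γ ⟨a, b, A, R⟩ →
      PropWff S Γ ⟨a, b, B, R⟩ →
      Iso S Γ Δ ⟨a, b, A, R⟩ ⟨a, b, B, R⟩
  | cpiFst {Γ Δ a b A R B a' b' A' R' B' R₀} :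
      DefEq S Γ Δ (.all a b A R B) (.all a' b' A' R' B') .star R₀ →
      Iso S Γ Δ ⟨a, b, A, R⟩ ⟨a', b', A', R'⟩

/-- Definitional equality: `DefEq S Γ Δ a b A R` is `Γ; Δ ⊨ a ≡ b : A` at role `R`, where `Δ` is
the set of coercion variables that may be used as assumptions. -/
inductive DefEq (S : Sig) : Ctx → Finset ℕ → Tm → Tm → Tm → Role → Prop
  | assn {Γ Δ c a b A R} :
      CtxOk S Γ →
      HasCo Γ c ⟨a, b, A, R⟩ →
      c ∈ Δ →
      DefEq S Γ Δ a b A R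
  | refl {Γ Δ a A R} : Typing S Γ a A → DefEq S Γ Δ a a A R
  | symm {Γ Δ a b A R} : DefEq S Γ Δ b a A R → DefEq S Γ Δ a b A R
  | trans {Γ Δ a a₁ b A R} :
      DefEq S Γ Δ a a₁ A R → DefEq S Γ Δ a₁ b A R → DefEq S Γ Δ a b A R
  | sub {Γ Δ a b A R₁ R₂} : DefEq S Γ Δ a b A R₁ → R₁.Sub R₂ → DefEq S Γ Δ a b A R₂
  | beta {Γ Δ a₁ a₂ B R} :
      Typing S Γ a₁ B →
      Typing S Γ a₂ B →
      Beta S a₁ a₂ R →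
      DefEq S Γ Δ a₁ a₂ B R
  | piCong {Γ Δ r A₁ B₁ A₂ B₂ R} :
      DefEq S Γ Δ A₁ A₂ .star R →
      DefEq S (.tm A₁ :: Γ) Δ B₁ B₂ .star R →
      Typing S Γ A₁ .star →
      Typing S Γ (.pi r A₁ B₁) .star →
      Typing S Γ (.pi r A₂ B₂) .star →
      DefEq S Γ Δ (.pi r A₁ B₁) (.pi r A₂ B₂) .star R
  | absCong {Γ Δ r b₁ b₂ A B R} :
      DefEq S (.tm A :: Γ) Δ b₁ b₂ B R →
      Typing S Γ A .star →
      RhoCheck r b₁ →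
      RhoCheck r b₂ →
      DefEq S Γ Δ (.lam r b₁) (.lam r b₂) (.pi r A B) R
  | appCong {Γ Δ a₁ a₂ b₁ b₂ A B R} :
      DefEq S Γ Δ a₁ b₁ (.pi .plus A B) R →
      DefEq S Γ Δ a₂ b₂ A .nom →
      DefEq S Γ Δ (.app a₁ (.rho .plus) a₂) (.app b₁ (.rho .plus) b₂) (B.inst a₂) R
  | tappCong {Γ Δ a₁ a₂ b₁ b₂ A B R R' Rs} :
      DefEq S Γ Δ a₁ b₁ (.pi .plus A B) R' →
      DefEq S Γ Δ a₂ b₂ A (R.min R') →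
      Roles S a₁ (R :: Rs) →
      Roles S b₁ (R :: Rs) →
      Typing S Γ (.app b₁ (.role R) b₂) (B.inst a₂) →
      DefEq S Γ Δ (.app a₁ (.role R) a₂) (.app b₁ (.role R) b₂) (B.inst a₂) R'
  | iappCong {Γ Δ a₁ b₁ a A B R} :
      DefEq S Γ Δ a₁ b₁ (.pi .minus A B) R →
      Typing S Γ a A →
      DefEq S Γ Δ (.app a₁ (.rho .minus) .box) (.app b₁ (.rho .minus) .box) (B.inst a) R
  | piFst {Γ Δ r A₁ B₁ A₂ B₂ R} :
      DefEq S Γ Δ (.pi r A₁ B₁) (.pi r A₂ B₂) .star R →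
      DefEq S Γ Δ A₁ A₂ .star R
  | piSnd {Γ Δ r A₁ B₁ A₂ B₂ a₁ a₂ R} :
      DefEq S Γ Δ (.pi r A₁ B₁) (.pi r A₂ B₂) .star R →
      DefEq S Γ Δ a₁ a₂ A₁ .nom →
      DefEq S Γ Δ (B₁.inst a₁) (B₂.inst a₂) .star R
  | cpiCong {Γ Δ a b A R B a' b' A' R' B' R₀} :
      Iso S Γ Δ ⟨a, b, A, R⟩ ⟨a', b', A', R'⟩ →
      DefEq S (.co ⟨a, b, A, R⟩ :: Γ) (shiftCo Δ) B B' .star R₀ →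
      PropWff S Γ ⟨a, b, A, R⟩ →
      Typing S Γ (.all a b A R B) .star →
      Typing S Γ (.all a' b' A' R' B') .star →
      DefEq S Γ Δ (.all a b A R B) (.all a' b' A' R' B') .star R₀
  | cabsCong {Γ Δ a₁ a₂ a b A R B R₀} :
      DefEq S (.co ⟨a, b, A, R⟩ :: Γ) (shiftCo Δ) a₁ a₂ B R₀ →
      PropWff S Γ ⟨a, b, A, R⟩ →
      DefEq S Γ Δ (.clam a₁) (.clam a₂) (.all a b A R B) R₀
  | cappCong {Γ Δ a₁ b₁ a b A R B R₀} :
      DefEq S Γ Δ a₁ b₁ (.all a b A R B) R₀ →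
      DefEq S Γ (coDom Γ) a b A R →
      DefEq S Γ Δ (.capp a₁) (.capp b₁) B R₀
  | cpiSnd {Γ Δ a b A R B a' b' A' R' B' R₀} :
      DefEq S Γ Δ (.all a b A R B) (.all a' b' A' R' B') .star R₀ →
      DefEq S Γ (coDom Γ) a b A R →
      DefEq S Γ (coDom Γ) a' b' A' R' →
      DefEq S Γ Δ B B' .star R₀
  | cast {Γ Δ a b A R a' b' A' R'} :
      DefEq S Γ Δ a b A R →
      Iso S Γ Δ ⟨a, b, A, R⟩ ⟨a', b', A', R'⟩ →
      DefEq S Γ Δ a' b' A' R'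
  | eqConv {Γ Δ a b A B R} :
      DefEq S Γ Δ a b A R →
      DefEq S Γ (coDom Γ) A B .star .rep →
      DefEq S Γ Δ a b B R
  | isoSnd {Γ Δ a b A R a' b' A' R'} :
      Iso S Γ Δ ⟨a, b, A, R⟩ ⟨a', b', A', R'⟩ →
      DefEq S Γ Δ A A' .star .rep
  | patCong {Γ Δ a a' A F us b₁ b₁' b₂ b₂' A₁ B B' C R} :
      DefEq S Γ Δ a a' A .nom →
      DefEq S Γ Δ b₁ b₁' B R →
      DefEq S Γ Δ b₂ b₂' C R →
      Typing S Γ (.const F) A₁ →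
      BranchTyping a A (.const F) A₁ us B C →
      BranchTyping a' A (.const F) A₁ us B' C →
      DefEq S Γ (coDom Γ) B B' .star .rep →
      SatApp S F us →
      DefEq S Γ Δ (.caseOf a F us b₁ b₂) (.caseOf a' F us b₁' b₂') C R
  | leftRel {Γ Δ a b a' b' A B F R₁ R} :
      CasePath S R (.app a (.role R₁) b) F →
      CasePath S R (.app a' (.role R₁) b') F →
      Typing S Γ a (.pi .plus A B) →
      Typing S Γ b A →
      Typing S Γ a' (.pi .plus A B) →
      Typing S Γ b' A →
      DefEq S Γ Δ (.app a (.role R₁) b) (.app a' (.role R₁) b') (B.inst b) R →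
      DefEq S Γ (coDom Γ) (B.inst b) (B.inst b') .star .rep →
      DefEq S Γ Δ a a' (.pi .plus A B) R
  | leftIrr {Γ Δ a b a' b' A B F R} :
      CasePath S R (.app a (.rho .minus) .box) F →
      CasePath S R (.app a' (.rho .minus) .box) F →
      Typing S Γ a (.pi .minus A B) →
      Typing S Γ b A →
      Typing S Γ a' (.pi .minus A B) →
      Typing S Γ b' A →
      DefEq S Γ Δ (.app a (.rho .minus) .box) (.app a' (.rho .minus) .box) (B.inst b) R →
      DefEq S Γ (coDom Γ) (B.inst b) (B.inst b') .star .rep →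
      DefEq S Γ Δ a a' (.pi .minus A B) R
  | right {Γ Δ a b a' b' A B F R₁ R} :
      CasePath S R (.app a (.role R₁) b) F →
      CasePath S R (.app a' (.role R₁) b') F →
      Typing S Γ a (.pi .plus A B) →
      Typing S Γ b A →
      Typing S Γ a' (.pi .plus A B) →
      Typing S Γ b' A →
      DefEq S Γ Δ (.app a (.role R₁) b) (.app a' (.role R₁) b') (B.inst b) R →
      DefEq S Γ (coDom Γ) (B.inst b) (B.inst b') .star .rep →
      DefEq S Γ Δ b b' A (R₁.min R)
  | cleft {Γ Δ a a' a₁ a₂ A R₁ B F R} :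
      CasePath S R (.capp a) F →
      CasePath S R (.capp a') F →
      Typing S Γ a (.all a₁ a₂ A R₁ B) →
      Typing S Γ a' (.all a₁ a₂ A R₁ B) →
      DefEq S Γ (coDom Γ) a₁ a₂ A R₁ →
      DefEq S Γ Δ (.capp a) (.capp a') B R →
      DefEq S Γ Δ a a' (.all a₁ a₂ A R₁ B) R

/-- Well-formed contexts. -/
inductive CtxOk (S : Sig) : Ctx → Prop
  | empty : CtxOk S []
  | consTm {Γ A} : CtxOk S Γ → Typing S Γ A .star → CtxOk S (.tm A :: Γ)
  | consCo {Γ φ} : CtxOk S Γ → PropWff S Γ φ → CtxOk S (.co φ :: Γ)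

end

/-! ## Role-checking and well-formed signatures -/

/-- Role-checking contexts: the roles of the term variables, the most recent one first.  A variable
with no role is not available at all. -/
abbrev RoleCtx := List (Option Role)

/-- `Roleing W a R`: the term `a` role-checks at role `R` in the role-checking context `W`. -/
inductive Roleing : RoleCtx → Tm → Role → Prop
  | star {W R} : Roleing W .star R
  | box {W R} : Roleing W .box R
  | const {W F R} : Roleing W (.const F) R
  | var {W : RoleCtx} {x R₁ R} : W[x]? = some (some R₁) → R₁.Sub R → Roleing W (.var x) R
  | abs {W r b R} : Roleing (some .nom :: W) b R → Roleing W (.lam r b) R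
  | app {W a r b R} : Roleing W a R → Roleing W b .nom → Roleing W (.app a (.rho r) b) R
  | tapp {W a R₁ b R} : Roleing W a R → Roleing W b (R₁.min R) →
      Roleing W (.app a (.role R₁) b) R
  | pi {W r A B R} : Roleing W A R → Roleing (some .nom :: W) B R → Roleing W (.pi r A B) R
  | clam {W a R} : Roleing W a R → Roleing W (.clam a) R
  | capp {W a R} : Roleing W a R → Roleing W (.capp a) R
  | all {W a b A R₁ B R₀ R} : Roleing W a R₁ → Roleing W b R₁ → Roleing W A R₀ →
      Roleing W B R → Roleing W (.all a b A R₁ B) R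
  | caseOf {W a F us b₁ b₂ R} : Roleing W a .nom → Roleing W b₁ R → Roleing W b₂ R →
      Roleing W (.caseOf a F us b₁ b₂) R

/-- `PatCtx F A p Γ B W`: for the pattern `p` headed by `F : A`, the variables of the pattern are
declared in `Γ`, its type is `B`, and `W` is the role-checking context of its variables
(irrelevant arguments are not available). -/
inductive PatCtx (F : Const) (A : Tm) : Pat → Ctx → Tm → RoleCtx → Prop
  | const : PatCtx F A (.const F) [] A []
  | piRole {p Γ A' B W R} : PatCtx F A p Γ (.pi .plus A' B) W →
      PatCtx F A (.appRole p R) (.tm A' :: Γ) B (some R :: W)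
  | piPlus {p Γ A' B W} : PatCtx F A p Γ (.pi .plus A' B) W →
      PatCtx F A (.appPlus p) (.tm A' :: Γ) B (some .nom :: W)
  | piIrr {p Γ A' B W} : PatCtx F A p Γ (.pi .minus A' B) W →
      PatCtx F A (.appIrr p) (.tm A' :: Γ) B (none :: W)
  | all {p Γ a b A' R B W} : PatCtx F A p Γ (.all a b A' R B) W →
      PatCtx F A (.capp p) (.co ⟨a, b, A', R⟩ :: Γ) B W

/-- The list of roles of a role-checking context, in order of declaration. -/
def RoleCtx.rng (W : RoleCtx) : List Role := (W.filterMap id).reverse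

/-- `SigOk S₀ S`: the declarations in `S` are well-formed with respect to the signature `S₀`. -/
inductive SigOk (S₀ : Sig) : Sig → Prop
  | empty : SigOk S₀ []
  | consOpq {S F A Rs} :
      SigOk S₀ S →
      F ∉ S.map Prod.fst →
      Typing S₀ [] A .star →
      SigOk S₀ ((F, .opq A Rs) :: S)
  | consAx {S F A Rs p R a Γ B W} :
      SigOk S₀ S →
      F ∉ S.map Prod.fst →
      Typing S₀ [] A .star →
      PatCtx F A p Γ B W →
      Typing S₀ Γ a B →
      Roleing W a R →
      Rs = W.rng →
      SigOk S₀ ((F, .ax A Rs p R a) :: S)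

/-- Well-formed toplevel signatures; declarations may refer to each other in any order. -/
def WfSig (S : Sig) : Prop := SigOk S S

end SystemDR

/-!
If `Γ ⊨ a : A` then `Γ ⊨ A : star`. These typing rules are not immediate by induction on the
derivation.

* For a variable the context gives the claim, and for a constant its declaration, after weakening.
* For an application to a term the type is an instance of the codomain of a `Π`-type. That
  `Π`-type has type `star` by induction, so inversion (`Typing.pi_inv`) and substitution
  (`Typing.inst`) apply.
* For a coercion application `∀ c : φ. B` has type `star` by induction; since the rule demands that
  `φ` holds, the assumption `c` can be cut from the typing of `B` (`Typing.cut`).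

Weakening, substitution and cut are cases of one statement: the judgments can be transported along
any morphism of contexts that takes variables to well-typed terms and coercion assumptions to
provable equalities. Going below a binder needs weakening of those terms and equalities, so the
mutual induction over the judgments (`Typing.transport`, `DefEq.transport`) is carried out for an
abstract class of morphisms closed under binders, `MorphismClass`. The class is first taken to be
that of renamings (`IsRenaming`), which gives weakening, and then that of all substitutions
(`IsSubstitution`). The set `Δ` of available assumptions is transported separately from the set of
all assumptions, because the premises of some equality rules refer to the latter.

The transport needs reduction to be stable under substitution. The delicate rule is the default
branch of a case expression, with its negative premise; there the scrutinee is a value, and values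
keep their outermost form under substitution (`Value.appsPath_of_subst`). The type of a constant is typed in the
empty context, hence closed (`Typing.subst_eq_self`), and is therefore not changed at all.
-/

namespace SystemDR

/-! ### Substitution calculus -/

theorem upSub_var_comp (f : ℕ → ℕ) :
    upSub (fun n => .var (f n)) = fun n => .var (upRen f n) := by
  funext n; cases n <;> rfl

theorem Tm.rename_eq_subst (a : Tm) (f : ℕ → ℕ) : a.rename f = a.subst (fun n => .var (f n)) := by
  induction a generalizing f <;> simp_all [Tm.rename, Tm.subst, upSub_var_comp]

theorem upSub_var : upSub Tm.var = Tm.var := by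
  funext n; cases n <;> rfl

@[simp]
theorem Tm.subst_var (a : Tm) : a.subst Tm.var = a := by
  induction a <;> simp_all [Tm.subst, upSub_var]

theorem upSub_comp_upRen (s : ℕ → Tm) (f : ℕ → ℕ) :
    (fun n => upSub s (upRen f n)) = upSub (fun n => s (f n)) := by
  funext n; cases n <;> rfl

theorem Tm.subst_rename (a : Tm) (f : ℕ → ℕ) (s : ℕ → Tm) :
    (a.rename f).subst s = a.subst (fun n => s (f n)) := by
  induction a generalizing f s <;> simp_all [Tm.rename, Tm.subst, upSub_comp_upRen]

theorem Tm.shift_rename_upRen (a : Tm) (f : ℕ → ℕ) :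
    a.shift.rename (upRen f) = (a.rename f).shift := by
  simp only [Tm.shift]
  rw [rename_eq_subst, subst_rename, rename_eq_subst (a.rename f), subst_rename]
  rfl

theorem rename_upRen_comp_upSub (s : ℕ → Tm) (f : ℕ → ℕ) :
    (fun n => (upSub s n).rename (upRen f)) = upSub (fun n => (s n).rename f) := by
  funext n
  cases n with
  | zero => rfl
  | succ n => exact Tm.shift_rename_upRen _ _

theorem Tm.rename_subst (a : Tm) (s : ℕ → Tm) (f : ℕ → ℕ) :
    (a.subst s).rename f = a.subst (fun n => (s n).rename f) := by
  induction a generalizing f s <;> simp_all [Tm.rename, Tm.subst, rename_upRen_comp_upSub]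

/-- Weakening commutes with substitution. -/
theorem Tm.shift_subst (a : Tm) (s : ℕ → Tm) : a.shift.subst (upSub s) = (a.subst s).shift := by
  simp only [Tm.shift]
  rw [subst_rename, rename_subst]
  rfl

theorem subst_upSub_comp_upSub (s t : ℕ → Tm) :
    (fun n => (upSub s n).subst (upSub t)) = upSub (fun n => (s n).subst t) := by
  funext n
  cases n with
  | zero => rfl
  | succ n => exact Tm.shift_subst _ _

theorem Tm.subst_subst (a : Tm) (s t : ℕ → Tm) :
    (a.subst s).subst t = a.subst (fun n => (s n).subst t) := by
  induction a generalizing s t <;> simp_all [Tm.subst, subst_upSub_comp_upSub]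

theorem Tm.shift_inst (a b : Tm) : a.shift.inst b = a := by
  simp only [Tm.shift, Tm.inst]
  rw [subst_rename]
  exact subst_var a

theorem Tm.inst_subst (B a : Tm) (s : ℕ → Tm) :
    (B.inst a).subst s = (B.subst (upSub s)).inst (a.subst s) := by
  simp only [Tm.inst]
  rw [subst_subst, subst_subst]
  congr 1
  funext n
  cases n with
  | zero => rfl
  | succ n => exact (Tm.shift_inst (s n) (a.subst s)).symm

theorem Tm.subst_congr_free {a : Tm} {s t : ℕ → Tm} (h : ∀ n, a.Free n → s n = t n) :
    a.subst s = a.subst t := by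
  have up : ∀ {b : Tm} {s t : ℕ → Tm}, (∀ n, b.Free (n + 1) → s n = t n) →
      ∀ n, b.Free n → upSub s n = upSub t n := by
    intro b s t h n hn
    cases n with
    | zero => rfl
    | succ n => exact congrArg Tm.shift (h n hn)
  induction a generalizing s t with
  | star | const | box => rfl
  | var n => exact h n rfl
  | lam r b ih => exact congrArg _ (ih (up h))
  | app a v b iha ihb =>
    simp only [Tm.subst, iha fun n hn => h n (.inl hn), ihb fun n hn => h n (.inr hn)]
  | pi r A B ihA ihB =>
    simp only [Tm.subst, ihA fun n hn => h n (.inl hn), ihB (up fun n hn => h n (.inr hn))]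
  | clam a ih => exact congrArg _ (ih h)
  | capp a ih => exact congrArg _ (ih h)
  | all a b A R B iha ihb ihA ihB =>
    simp only [Tm.subst, iha fun n hn => h n (.inl hn), ihb fun n hn => h n (.inr (.inl hn)),
      ihA fun n hn => h n (.inr (.inr (.inl hn))), ihB fun n hn => h n (.inr (.inr (.inr hn)))]
  | caseOf a F us b₁ b₂ iha ih₁ ih₂ =>
    simp only [Tm.subst, iha fun n hn => h n (.inl hn), ih₁ fun n hn => h n (.inr (.inl hn)),
      ih₂ fun n hn => h n (.inr (.inr hn))]

/-- A term without free variables is not changed by substitution. -/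
theorem Tm.subst_eq_self {a : Tm} (h : ∀ n, ¬ a.Free n) (s : ℕ → Tm) : a.subst s = a :=
  (subst_congr_free fun n hn => absurd hn (h n)).trans a.subst_var

theorem Tm.exists_free_of_free_rename {a : Tm} {f : ℕ → ℕ} {n : ℕ} (h : (a.rename f).Free n) :
    ∃ m, a.Free m ∧ f m = n := by
  have up : ∀ {b : Tm} {f : ℕ → ℕ} {n : ℕ}, (∃ m, b.Free m ∧ upRen f m = n + 1) →
      ∃ m, b.Free (m + 1) ∧ f m = n := by
    rintro b f n ⟨m | m, hm, e⟩
    · cases e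
    · exact ⟨m, hm, Nat.succ.inj e⟩
  induction a generalizing f n with
  | star | const | box => cases h
  | var m => exact ⟨m, rfl, h⟩
  | lam r b ih => exact up (ih h)
  | clam a ih | capp a ih => exact ih h
  | app a v b iha ihb =>
    rcases h with h | h
    · exact (iha h).imp fun m hm => ⟨.inl hm.1, hm.2⟩
    · exact (ihb h).imp fun m hm => ⟨.inr hm.1, hm.2⟩
  | pi r A B ihA ihB =>
    rcases h with h | h
    · exact (ihA h).imp fun m hm => ⟨.inl hm.1, hm.2⟩
    · exact (up (ihB h)).imp fun m hm => ⟨.inr hm.1, hm.2⟩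
  | all a b A R B iha ihb ihA ihB =>
    rcases h with h | h | h | h
    · exact (iha h).imp fun m hm => ⟨.inl hm.1, hm.2⟩
    · exact (ihb h).imp fun m hm => ⟨.inr (.inl hm.1), hm.2⟩
    · exact (ihA h).imp fun m hm => ⟨.inr (.inr (.inl hm.1)), hm.2⟩
    · exact (ihB h).imp fun m hm => ⟨.inr (.inr (.inr hm.1)), hm.2⟩
  | caseOf a F us b₁ b₂ iha ih₁ ih₂ =>
    rcases h with h | h | h
    · exact (iha h).imp fun m hm => ⟨.inl hm.1, hm.2⟩
    · exact (ih₁ h).imp fun m hm => ⟨.inr (.inl hm.1), hm.2⟩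
    · exact (ih₂ h).imp fun m hm => ⟨.inr (.inr hm.1), hm.2⟩

theorem Tm.exists_free_of_free_subst {a : Tm} {s : ℕ → Tm} {n : ℕ} (h : (a.subst s).Free n) :
    ∃ m, a.Free m ∧ (s m).Free n := by
  have up : ∀ {b : Tm} {s : ℕ → Tm} {n : ℕ}, (∃ m, b.Free m ∧ (upSub s m).Free (n + 1)) →
      ∃ m, b.Free (m + 1) ∧ (s m).Free n := by
    rintro b s n ⟨m | m, hm, e⟩
    · cases e
    · obtain ⟨k, hk, e⟩ := exists_free_of_free_rename e
      exact ⟨m, hm, Nat.succ.inj e ▸ hk⟩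
  induction a generalizing s n with
  | star | const | box => cases h
  | var m => exact ⟨m, rfl, h⟩
  | lam r b ih => exact up (ih h)
  | clam a ih | capp a ih => exact ih h
  | app a v b iha ihb =>
    rcases h with h | h
    · exact (iha h).imp fun m hm => ⟨.inl hm.1, hm.2⟩
    · exact (ihb h).imp fun m hm => ⟨.inr hm.1, hm.2⟩
  | pi r A B ihA ihB =>
    rcases h with h | h
    · exact (ihA h).imp fun m hm => ⟨.inl hm.1, hm.2⟩
    · exact (up (ihB h)).imp fun m hm => ⟨.inr hm.1, hm.2⟩
  | all a b A R B iha ihb ihA ihB =>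
    rcases h with h | h | h | h
    · exact (iha h).imp fun m hm => ⟨.inl hm.1, hm.2⟩
    · exact (ihb h).imp fun m hm => ⟨.inr (.inl hm.1), hm.2⟩
    · exact (ihA h).imp fun m hm => ⟨.inr (.inr (.inl hm.1)), hm.2⟩
    · exact (ihB h).imp fun m hm => ⟨.inr (.inr (.inr hm.1)), hm.2⟩
  | caseOf a F us b₁ b₂ iha ih₁ ih₂ =>
    rcases h with h | h | h
    · exact (iha h).imp fun m hm => ⟨.inl hm.1, hm.2⟩
    · exact (ih₁ h).imp fun m hm => ⟨.inr (.inl hm.1), hm.2⟩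
    · exact (ih₂ h).imp fun m hm => ⟨.inr (.inr hm.1), hm.2⟩

theorem RhoCheck.subst {r : Rel} {b : Tm} (h : RhoCheck r b) (s : ℕ → Tm) :
    RhoCheck r (b.subst (upSub s)) := by
  cases r with
  | plus => trivial
  | minus =>
    intro h0
    obtain ⟨m | m, hm, e⟩ := Tm.exists_free_of_free_subst h0
    · exact h hm
    · obtain ⟨k, -, e⟩ := Tm.exists_free_of_free_rename e
      cases e

/-! ### Paths, values and reduction under substitution -/

variable {S : Sig}

theorem Roles.subst {a : Tm} {Rs : List Role} (h : Roles S a Rs) (s : ℕ → Tm) :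
    Roles S (a.subst s) Rs := by
  induction h with
  | opq h => exact .opq h
  | ax h => exact .ax h
  | tapp _ ih => exact .tapp ih
  | app _ ih => exact .app ih
  | iapp _ ih => exact .iapp ih
  | capp _ ih => exact .capp ih

theorem Head.subst {a : Tm} {F : Const} (h : Head S a F) (s : ℕ → Tm) : Head S (a.subst s) F := by
  induction h with
  | opq h => exact .opq h
  | ax h => exact .ax h
  | app _ ih => exact .app ih
  | capp _ ih => exact .capp ih

theorem Match.subst {a : Tm} {p : Pat} {l : List Tm} (h : Match a p l) (s : ℕ → Tm) :
    Match (a.subst s) p (l.map (Tm.subst s)) := by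
  induction h with
  | const => exact .const
  | appRole _ ih => exact .appRole ih
  | appPlus _ ih => exact .appPlus ih
  | appIrr _ ih => exact .appIrr ih
  | capp _ ih => exact .capp ih

theorem Head.match_of_subst {a : Tm} {F : Const} (h : Head S a F) {s : ℕ → Tm} {p : Pat}
    {l : List Tm} (hm : Match (a.subst s) p l) : ∃ l', Match a p l' := by
  induction h generalizing p l with
  | opq h | ax h => exact ⟨_, hm⟩
  | app _ ih =>
    cases hm with
    | appRole hm => obtain ⟨l', h⟩ := ih hm; exact ⟨_, .appRole h⟩
    | appPlus hm => obtain ⟨l', h⟩ := ih hm; exact ⟨_, .appPlus h⟩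
    | appIrr hm => obtain ⟨l', h⟩ := ih hm; exact ⟨_, .appIrr h⟩
  | capp _ ih =>
    cases hm with
    | capp hm => obtain ⟨l', h⟩ := ih hm; exact ⟨_, .capp h⟩

theorem Head.prefixMatch_of_subst {a : Tm} {F : Const} (h : Head S a F) {s : ℕ → Tm} {p : Pat}
    (hm : PrefixMatch (a.subst s) p) : PrefixMatch a p := by
  induction h with
  | opq h | ax h => exact hm
  | app h ih =>
    cases hm with
    | base hm => obtain ⟨l', h⟩ := (Head.app h).match_of_subst hm; exact .base h
    | app hm => exact .app (ih hm)
  | capp h ih =>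
    cases hm with
    | base hm => obtain ⟨l', h⟩ := (Head.capp h).match_of_subst hm; exact .base h
    | capp hm => exact .capp (ih hm)

theorem CasePath.subst {R : Role} {a : Tm} {F : Const} (h : CasePath S R a F) (s : ℕ → Tm) :
    CasePath S R (a.subst s) F := by
  cases h with
  | opq h hF => exact .opq (h.subst s) hF
  | ax h hF hR => exact .ax (h.subst s) hF hR
  | unmatch h hF hp => exact .unmatch (h.subst s) hF fun hm => hp (h.prefixMatch_of_subst hm)

theorem CasePath.head {R : Role} {a : Tm} {F : Const} (h : CasePath S R a F) : Head S a F := by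
  cases h <;> assumption

theorem Value.subst {R : Role} {a : Tm} (h : Value S R a) (s : ℕ → Tm) :
    Value S R (a.subst s) := by
  induction h generalizing s with
  | star => exact .star
  | pi => exact .pi
  | all => exact .all
  | lamRel => exact .lamRel
  | lamIrr _ ih => exact .lamIrr (ih _)
  | clam => exact .clam
  | path h => exact .path (h.subst s)

theorem AppsPath.subst {R : Role} {a : Tm} {F : Const} {us : List Flag}
    (h : AppsPath S R a F us) (s : ℕ → Tm) : AppsPath S R (a.subst s) F us := by
  induction h with
  | opq h => exact .opq h
  | ax h hR => exact .ax h hR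
  | app _ ih => exact .app ih
  | capp _ ih => exact .capp ih

theorem Head.appsPath_of_subst {R : Role} {a : Tm} {F G : Const} (h : Head S a G)
    {s : ℕ → Tm} {us : List Flag} (ha : AppsPath S R (a.subst s) F us) :
    AppsPath S R a F us := by
  induction h generalizing us with
  | opq h | ax h => exact ha
  | app h ih =>
    cases ha with
    | app ha => exact .app (ih ha)
  | capp h ih =>
    cases ha with
    | capp ha => exact .capp (ih ha)

/-- Substitution cannot turn a value into an applied constant that it was not before. This makes the
default reduction of case expressions, which has a negative premise, stable under substitution. -/
theorem Value.appsPath_of_subst {R R' : Role} {a : Tm} (h : Value S R a) {F : Const}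
    {s : ℕ → Tm} {us : List Flag} (ha : AppsPath S R' (a.subst s) F us) :
    AppsPath S R' a F us := by
  cases h with
  | path h => exact h.head.appsPath_of_subst ha
  | _ => cases ha

theorem ApplyArgs.subst {a b b' : Tm} (h : ApplyArgs a b b') (s : ℕ → Tm) :
    ApplyArgs (a.subst s) (b.subst s) (b'.subst s) := by
  induction h with
  | const => exact .const
  | appRole _ ih => exact .appRole ih
  | appRho _ ih => exact .appRho ih
  | capp _ ih => exact .capp ih

theorem MatchSubst.subst {a b b' : Tm} {p : Pat} (h : MatchSubst a p b b') (s : ℕ → Tm) :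
    MatchSubst (a.subst s) p b (b'.subst s) := by
  obtain ⟨l, hm, rfl⟩ := h
  refine ⟨_, hm.subst s, ?_⟩
  rw [Tm.subst_subst]
  congr 1
  funext n
  -- beyond the end of the list both sides are `box`, which is closed
  exact (List.getD_map l Tm.box (Tm.subst s)).symm

theorem Beta.subst {a b : Tm} {R : Role} (h : Beta S a b R) (s : ℕ → Tm) :
    Beta S (a.subst s) (b.subst s) R := by
  cases h with
  | appAbs hv =>
    rw [Tm.inst_subst]
    exact .appAbs (hv.subst s)
  | cappCabs => exact .cappCabs
  | ax hF hm hR => exact .ax hF (hm.subst s) hR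
  | patTrue ha hb => exact .patTrue (ha.subst s) (hb.subst s)
  | patFalse hv ha => exact .patFalse (hv.subst s) fun h => ha (hv.appsPath_of_subst h)

theorem BranchTyping.subst {a A b B : Tm} {us : List Flag} {D C : Tm}
    (h : BranchTyping a A b B us D C) (s : ℕ → Tm) :
    BranchTyping (a.subst s) (A.subst s) (b.subst s) (B.subst s) us (D.subst s) (C.subst s) := by
  induction h generalizing s with
  | base => exact .base
  | piRole _ ih =>
    have := ih (upSub s)
    simp only [Tm.subst, Tm.shift_subst] at this
    exact .piRole this
  | piRel _ ih =>
    have := ih (upSub s)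
    simp only [Tm.subst, Tm.shift_subst] at this
    exact .piRel this
  | piIrr _ ih =>
    have := ih (upSub s)
    simp only [Tm.subst, Tm.shift_subst] at this
    exact .piIrr this
  | all _ ih => exact .all (ih s)

/-! ### Contexts and closed terms -/

/-- Substitution in a proposition. -/
def EqProp.subst (s : ℕ → Tm) (φ : EqProp) : EqProp :=
  ⟨φ.lhs.subst s, φ.rhs.subst s, φ.ty.subst s, φ.role⟩

@[simp]
theorem EqProp.subst_var (φ : EqProp) : φ.subst Tm.var = φ := by
  simp [EqProp.subst]

theorem EqProp.shift_subst (φ : EqProp) (s : ℕ → Tm) :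
    φ.shift.subst (upSub s) = (φ.subst s).shift := by
  simp only [EqProp.subst, EqProp.shift, Tm.shift_subst]

theorem HasCo.mem_coDom {Γ : Ctx} {c : ℕ} {φ : EqProp} (h : HasCo Γ c φ) : c ∈ coDom Γ := by
  simp only [coDom, Finset.mem_range]
  induction h with
  | here => exact Nat.succ_pos _
  | skipTm _ ih => exact ih
  | skipCo _ ih => exact Nat.succ_lt_succ ih

theorem succ_mem_shiftCo {Δ : Finset ℕ} {c : ℕ} : c + 1 ∈ shiftCo Δ ↔ c ∈ Δ := by
  simp [shiftCo]

theorem zero_notMem_shiftCo (Δ : Finset ℕ) : 0 ∉ shiftCo Δ := by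
  simp [shiftCo]

/-- The number of term variables of a context. -/
def numTm : Ctx → ℕ
  | [] => 0
  | .tm _ :: Γ => numTm Γ + 1
  | .co _ :: Γ => numTm Γ

theorem HasTm.lt_numTm {Γ : Ctx} {x : ℕ} {A : Tm} (h : HasTm Γ x A) : x < numTm Γ := by
  induction h with
  | here => exact Nat.succ_pos _
  | skipTm _ ih => exact Nat.succ_lt_succ ih
  | skipCo _ ih => exact ih

mutual

theorem Typing.lt_numTm_of_free {Γ : Ctx} {a A : Tm} {n : ℕ} :
    Typing S Γ a A → a.Free n → n < numTm Γ
  | .star _, h => h.elim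
  | .var _ hx, h => h ▸ hx.lt_numTm
  | .pi hB hA, h =>
    h.elim hA.lt_numTm_of_free fun h => Nat.lt_of_succ_lt_succ (hB.lt_numTm_of_free h)
  | .abs hb _ _, h => Nat.lt_of_succ_lt_succ (hb.lt_numTm_of_free h)
  | .app hb ha, h => h.elim hb.lt_numTm_of_free ha.lt_numTm_of_free
  | .tapp hb ha _, h => h.elim hb.lt_numTm_of_free ha.lt_numTm_of_free
  | .iapp hb _, h => h.elim hb.lt_numTm_of_free False.elim
  | .conv ha _ _, h => ha.lt_numTm_of_free h
  | .cpi hB hφ, h => by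
    rcases h with h | h | h | h
    · exact hφ.lt_numTm_of_free (.inl h)
    · exact hφ.lt_numTm_of_free (.inr (.inl h))
    · exact hφ.lt_numTm_of_free (.inr (.inr h))
    · exact hB.lt_numTm_of_free h
  | .cabs ha _, h => ha.lt_numTm_of_free h
  | .capp ha _, h => ha.lt_numTm_of_free h
  | .const _ _ _, h => h.elim
  | .fam _ _ _, h => h.elim
  | .caseOf ha _ h₁ h₂ _ _, h =>
    h.elim ha.lt_numTm_of_free fun h => h.elim h₁.lt_numTm_of_free h₂.lt_numTm_of_free

theorem PropWff.lt_numTm_of_free {Γ : Ctx} {φ : EqProp} {n : ℕ} :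
    PropWff S Γ φ → (φ.lhs.Free n ∨ φ.rhs.Free n ∨ φ.ty.Free n) → n < numTm Γ
  | .wff ha hb hA, h =>
    h.elim ha.lt_numTm_of_free fun h => h.elim hb.lt_numTm_of_free hA.lt_numTm_of_free

end

/-- A term that is typed in the empty context is closed. -/
theorem Typing.subst_eq_self {a A : Tm} (h : Typing S [] a A) (s : ℕ → Tm) : a.subst s = a :=
  Tm.subst_eq_self (fun _ hn => Nat.not_lt_zero _ (h.lt_numTm_of_free hn)) s

mutual

theorem Typing.ctxOk {Γ : Ctx} {a A : Tm} : Typing S Γ a A → CtxOk S Γ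
  | .star h | .var h _ | .const h _ _ | .fam h _ _ => h
  | .pi _ h | .abs _ h _ | .app h _ | .tapp h _ _ | .iapp h _ | .conv h _ _ | .capp h _
  | .caseOf h _ _ _ _ _ => h.ctxOk
  | .cpi _ h | .cabs _ h => h.ctxOk

theorem PropWff.ctxOk {Γ : Ctx} {φ : EqProp} : PropWff S Γ φ → CtxOk S Γ
  | .wff h _ _ => h.ctxOk

end

/-! ### Context morphisms -/

/-- A class of morphisms of contexts along which the judgments can be transported.
`J Γ Δ Γ' Δ' s` says that the substitution `s` takes the variables of `Γ` to terms over `Γ'`, and the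
assumptions in `Δ` to equalities that hold over `Γ'` with the assumptions in `Δ'`. The class has to
be closed under passing below a binder; for a coercion binder, the new assumption may be either
unavailable or, when all assumptions are available, available as well. -/
structure MorphismClass (S : Sig) (J : Ctx → Finset ℕ → Ctx → Finset ℕ → (ℕ → Tm) → Prop) :
    Prop where
  ctxOk {Γ Δ Γ' Δ' s} : J Γ Δ Γ' Δ' s → CtxOk S Γ'
  var {Γ Δ Γ' Δ' s x A} : J Γ Δ Γ' Δ' s → HasTm Γ x A → Typing S Γ' (s x) (A.subst s)
  assn {Γ Δ Γ' Δ' s c φ} : J Γ Δ Γ' Δ' s → HasCo Γ c φ → c ∈ Δ →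
    DefEq S Γ' Δ' (φ.lhs.subst s) (φ.rhs.subst s) (φ.ty.subst s) φ.role
  consTm {Γ Δ Γ' Δ' s A} : J Γ Δ Γ' Δ' s → Typing S Γ' (A.subst s) .star →
    J (.tm A :: Γ) Δ (.tm (A.subst s) :: Γ') Δ' (upSub s)
  consCo {Γ Δ Γ' Δ' s φ} : J Γ Δ Γ' Δ' s → PropWff S Γ' (φ.subst s) →
    J (.co φ :: Γ) (shiftCo Δ) (.co (φ.subst s) :: Γ') (shiftCo Δ') s
  consCoDom {Γ Γ' s φ} : J Γ (coDom Γ) Γ' (coDom Γ') s → PropWff S Γ' (φ.subst s) →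
    J (.co φ :: Γ) (coDom (.co φ :: Γ)) (.co (φ.subst s) :: Γ') (coDom (.co (φ.subst s) :: Γ')) s

mutual

theorem Typing.transport {J} (hJ : MorphismClass S J) {Γ Γ' : Ctx} {s : ℕ → Tm} {a A : Tm}
    (m : J Γ (coDom Γ) Γ' (coDom Γ') s) :
    Typing S Γ a A → Typing S Γ' (a.subst s) (A.subst s)
  | .star _ => .star (hJ.ctxOk m)
  | .var _ hx => hJ.var m hx
  | .pi hB hA =>
    have hA' := hA.transport hJ m
    .pi (hB.transport hJ (hJ.consTm m hA')) hA'
  | .abs hb hA hr =>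
    have hA' := hA.transport hJ m
    .abs (hb.transport hJ (hJ.consTm m hA')) hA' (hr.subst s)
  | .app hb ha => by
    rw [Tm.inst_subst]
    exact .app (hb.transport hJ m) (ha.transport hJ m)
  | .tapp hb ha hR => by
    rw [Tm.inst_subst]
    exact .tapp (hb.transport hJ m) (ha.transport hJ m) (hR.subst s)
  | .iapp hb ha => by
    rw [Tm.inst_subst]
    exact .iapp (hb.transport hJ m) (ha.transport hJ m)
  | .conv ha he hB => .conv (ha.transport hJ m) (he.transport hJ m m) (hB.transport hJ m)
  | .cpi hB hφ =>
    have hφ' := hφ.transport hJ m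
    .cpi (hB.transport hJ (hJ.consCoDom m hφ')) hφ'
  | .cabs ha hφ =>
    have hφ' := hφ.transport hJ m
    .cabs (ha.transport hJ (hJ.consCoDom m hφ')) hφ'
  | .capp ha he => .capp (ha.transport hJ m) (he.transport hJ m m)
  | .const _ hF hA => by
    rw [hA.subst_eq_self]
    exact .const (hJ.ctxOk m) hF hA
  | .fam _ hF hA => by
    rw [hA.subst_eq_self]
    exact .fam (hJ.ctxOk m) hF hA
  | .caseOf ha hF h₁ h₂ hb hs =>
    .caseOf (ha.transport hJ m) (hF.transport hJ m) (h₁.transport hJ m) (h₂.transport hJ m)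
      (hb.subst s) hs

theorem PropWff.transport {J} (hJ : MorphismClass S J) {Γ Γ' : Ctx} {s : ℕ → Tm} {φ : EqProp}
    (m : J Γ (coDom Γ) Γ' (coDom Γ') s) : PropWff S Γ φ → PropWff S Γ' (φ.subst s)
  | .wff ha hb hA => .wff (ha.transport hJ m) (hb.transport hJ m) (hA.transport hJ m)

theorem Iso.transport {J} (hJ : MorphismClass S J) {Γ Γ' : Ctx} {Δ Δ' : Finset ℕ} {s : ℕ → Tm}
    {φ ψ : EqProp} (m : J Γ (coDom Γ) Γ' (coDom Γ') s) (n : J Γ Δ Γ' Δ' s) :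
    Iso S Γ Δ φ ψ → Iso S Γ' Δ' (φ.subst s) (ψ.subst s)
  | .propCong ha hb => .propCong (ha.transport hJ m n) (hb.transport hJ m n)
  | .isoConv he hφ hψ => .isoConv (he.transport hJ m n) (hφ.transport hJ m) (hψ.transport hJ m)
  | .cpiFst he => .cpiFst (he.transport hJ m n)

theorem DefEq.transport {J} (hJ : MorphismClass S J) {Γ Γ' : Ctx} {Δ Δ' : Finset ℕ} {s : ℕ → Tm}
    {a b A : Tm} {R : Role} (m : J Γ (coDom Γ) Γ' (coDom Γ') s) (n : J Γ Δ Γ' Δ' s) :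
    DefEq S Γ Δ a b A R → DefEq S Γ' Δ' (a.subst s) (b.subst s) (A.subst s) R
  | .assn _ hc hΔ => hJ.assn n hc hΔ
  | .refl ha => .refl (ha.transport hJ m)
  | .symm h => .symm (h.transport hJ m n)
  | .trans h h' => .trans (h.transport hJ m n) (h'.transport hJ m n)
  | .sub h hR => .sub (h.transport hJ m n) hR
  | .beta ha hb h => .beta (ha.transport hJ m) (hb.transport hJ m) (h.subst s)
  | .piCong hA hB hA₁ h₁ h₂ =>
    have hA' := hA₁.transport hJ m
    .piCong (hA.transport hJ m n) (hB.transport hJ (hJ.consTm m hA') (hJ.consTm n hA')) hA'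
      (h₁.transport hJ m) (h₂.transport hJ m)
  | .absCong hb hA h₁ h₂ =>
    have hA' := hA.transport hJ m
    .absCong (hb.transport hJ (hJ.consTm m hA') (hJ.consTm n hA')) hA' (h₁.subst s) (h₂.subst s)
  | .appCong ha hb => by
    rw [Tm.inst_subst]
    exact .appCong (ha.transport hJ m n) (hb.transport hJ m n)
  | .tappCong ha hb h₁ h₂ ht => by
    have ht' := ht.transport hJ m
    rw [Tm.inst_subst] at ht' ⊢
    exact .tappCong (ha.transport hJ m n) (hb.transport hJ m n) (h₁.subst s) (h₂.subst s) ht'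
  | .iappCong ha hb => by
    rw [Tm.inst_subst]
    exact .iappCong (ha.transport hJ m n) (hb.transport hJ m)
  | .piFst h => .piFst (h.transport hJ m n)
  | .piSnd h ha => by
    rw [Tm.inst_subst, Tm.inst_subst]
    exact .piSnd (h.transport hJ m n) (ha.transport hJ m n)
  | .cpiCong hi hB hφ h₁ h₂ =>
    have hφ' := hφ.transport hJ m
    .cpiCong (hi.transport hJ m n) (hB.transport hJ (hJ.consCoDom m hφ') (hJ.consCo n hφ')) hφ'
      (h₁.transport hJ m) (h₂.transport hJ m)
  | .cabsCong ha hφ =>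
    have hφ' := hφ.transport hJ m
    .cabsCong (ha.transport hJ (hJ.consCoDom m hφ') (hJ.consCo n hφ')) hφ'
  | .cappCong ha he => .cappCong (ha.transport hJ m n) (he.transport hJ m m)
  | .cpiSnd h he he' =>
    .cpiSnd (h.transport hJ m n) (he.transport hJ m m) (he'.transport hJ m m)
  | .cast h hi => .cast (h.transport hJ m n) (hi.transport hJ m n)
  | .eqConv h he => .eqConv (h.transport hJ m n) (he.transport hJ m m)
  | .isoSnd hi => .isoSnd (hi.transport hJ m n)
  | .patCong ha h₁ h₂ hF hb hb' he hs =>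
    .patCong (ha.transport hJ m n) (h₁.transport hJ m n) (h₂.transport hJ m n)
      (hF.transport hJ m) (hb.subst s) (hb'.subst s) (he.transport hJ m m) hs
  | .leftRel hp hp' ha hb ha' hb' h he => by
    have h' := h.transport hJ m n
    have he' := he.transport hJ m m
    rw [Tm.inst_subst] at h' he'
    rw [Tm.inst_subst] at he'
    exact .leftRel (hp.subst s) (hp'.subst s) (ha.transport hJ m) (hb.transport hJ m)
      (ha'.transport hJ m) (hb'.transport hJ m) h' he'
  | .leftIrr hp hp' ha hb ha' hb' h he => by
    have h' := h.transport hJ m n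
    have he' := he.transport hJ m m
    rw [Tm.inst_subst] at h' he'
    rw [Tm.inst_subst] at he'
    exact .leftIrr (hp.subst s) (hp'.subst s) (ha.transport hJ m) (hb.transport hJ m)
      (ha'.transport hJ m) (hb'.transport hJ m) h' he'
  | .right hp hp' ha hb ha' hb' h he => by
    have h' := h.transport hJ m n
    have he' := he.transport hJ m m
    rw [Tm.inst_subst] at h' he'
    rw [Tm.inst_subst] at he'
    exact .right (hp.subst s) (hp'.subst s) (ha.transport hJ m) (hb.transport hJ m)
      (ha'.transport hJ m) (hb'.transport hJ m) h' he'
  | .cleft hp hp' ha ha' he h =>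
    .cleft (hp.subst s) (hp'.subst s) (ha.transport hJ m) (ha'.transport hJ m)
      (he.transport hJ m m) (h.transport hJ m n)

end

/-! ### Weakening -/

/-- Morphisms of contexts that take variables to variables and assumptions to assumptions. -/
def IsRenaming (S : Sig) (Γ : Ctx) (Δ : Finset ℕ) (Γ' : Ctx) (Δ' : Finset ℕ) (s : ℕ → Tm) : Prop :=
  CtxOk S Γ' ∧
  (∃ f : ℕ → ℕ, (s = fun n => .var (f n)) ∧ ∀ x A, HasTm Γ x A → HasTm Γ' (f x) (A.subst s)) ∧
  ∀ c φ, HasCo Γ c φ → ∃ c', HasCo Γ' c' (φ.subst s) ∧ (c ∈ Δ → c' ∈ Δ')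

theorem IsRenaming.morphismClass : MorphismClass S (IsRenaming S) where
  ctxOk m := m.1
  var := by
    rintro Γ Δ Γ' Δ' s x A ⟨hΓ, ⟨f, rfl, hf⟩, -⟩ hx
    exact .var hΓ (hf x A hx)
  assn := by
    rintro Γ Δ Γ' Δ' s c φ ⟨hΓ, -, hco⟩ hc hΔ
    obtain ⟨c', hc', h⟩ := hco c φ hc
    exact .assn hΓ hc' (h hΔ)
  consTm := by
    rintro Γ Δ Γ' Δ' s A ⟨hΓ, ⟨f, hs, hf⟩, hco⟩ hA
    refine ⟨.consTm hΓ hA, ⟨upRen f, ?_, ?_⟩, ?_⟩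
    · rw [hs, upSub_var_comp]
    · rintro x B (_ | hx)
      · rw [Tm.shift_subst]
        exact .here
      · rw [Tm.shift_subst]
        exact .skipTm (hf _ _ hx)
    · rintro c φ (_ | hc)
      obtain ⟨c', hc', h⟩ := hco _ _ hc
      rw [EqProp.shift_subst]
      exact ⟨c', .skipTm hc', h⟩
  consCo := by
    rintro Γ Δ Γ' Δ' s φ ⟨hΓ, ⟨f, hs, hf⟩, hco⟩ hφ
    refine ⟨.consCo hΓ hφ, ⟨f, hs, ?_⟩, ?_⟩
    · rintro x B (_ | _ | hx)
      exact .skipCo (hf _ _ hx)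
    · rintro c ψ (_ | _ | hc)
      · exact ⟨0, .here, fun h => absurd h (zero_notMem_shiftCo Δ)⟩
      · obtain ⟨c', hc', h⟩ := hco _ _ hc
        exact ⟨c' + 1, .skipCo hc', fun hΔ => succ_mem_shiftCo.2 (h (succ_mem_shiftCo.1 hΔ))⟩
  consCoDom := by
    rintro Γ Γ' s φ ⟨hΓ, ⟨f, hs, hf⟩, hco⟩ hφ
    refine ⟨.consCo hΓ hφ, ⟨f, hs, ?_⟩, ?_⟩
    · rintro x B (_ | _ | hx)
      exact .skipCo (hf _ _ hx)
    · rintro c ψ (_ | _ | hc)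
      · exact ⟨0, .here, fun _ => HasCo.here.mem_coDom⟩
      · obtain ⟨c', hc', h⟩ := hco _ _ hc
        exact ⟨c' + 1, .skipCo hc', fun _ => (HasCo.skipCo hc').mem_coDom⟩

theorem Tm.shift_eq_subst (a : Tm) : a.shift = a.subst fun n => .var (n + 1) :=
  a.rename_eq_subst Nat.succ

theorem EqProp.shift_eq_subst (φ : EqProp) : φ.shift = φ.subst fun n => .var (n + 1) := by
  simp only [EqProp.shift, EqProp.subst, Tm.shift_eq_subst]

theorem CtxOk.isRenaming_tm {Γ : Ctx} {Δ : Finset ℕ} {B : Tm} (h : CtxOk S (.tm B :: Γ)) :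
    IsRenaming S Γ Δ (.tm B :: Γ) Δ fun n => .var (n + 1) := by
  refine ⟨h, ⟨_, rfl, fun x A hx => ?_⟩, fun c φ hc => ⟨c, ?_, id⟩⟩
  · rw [← Tm.shift_eq_subst]
    exact .skipTm hx
  · rw [← EqProp.shift_eq_subst]
    exact .skipTm hc

theorem CtxOk.isRenaming_co {Γ : Ctx} {Δ Δ' : Finset ℕ} {φ : EqProp} (h : CtxOk S (.co φ :: Γ))
    (hΔ : ∀ c, c ∈ Δ → c + 1 ∈ Δ') : IsRenaming S Γ Δ (.co φ :: Γ) Δ' Tm.var := by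
  refine ⟨h, ⟨id, rfl, fun x A hx => ?_⟩, fun c ψ hc => ⟨c + 1, ?_, hΔ c⟩⟩
  · rw [Tm.subst_var]
    exact .skipCo hx
  · rw [EqProp.subst_var]
    exact .skipCo hc

theorem succ_mem_coDom_co {Γ : Ctx} {φ : EqProp} (c : ℕ) (h : c ∈ coDom Γ) :
    c + 1 ∈ coDom (.co φ :: Γ) :=
  Finset.mem_range.2 (Nat.succ_lt_succ (Finset.mem_range.1 h))

theorem Typing.weaken_tm {Γ : Ctx} {a A B : Tm} (h : Typing S Γ a A)
    (hΓ : CtxOk S (.tm B :: Γ)) : Typing S (.tm B :: Γ) a.shift A.shift := by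
  rw [Tm.shift_eq_subst, Tm.shift_eq_subst]
  exact h.transport IsRenaming.morphismClass hΓ.isRenaming_tm

theorem DefEq.weaken_tm {Γ : Ctx} {Δ : Finset ℕ} {a b A B : Tm} {R : Role}
    (h : DefEq S Γ Δ a b A R) (hΓ : CtxOk S (.tm B :: Γ)) :
    DefEq S (.tm B :: Γ) Δ a.shift b.shift A.shift R := by
  simp only [Tm.shift_eq_subst]
  exact h.transport IsRenaming.morphismClass hΓ.isRenaming_tm hΓ.isRenaming_tm

theorem Typing.weaken_co {Γ : Ctx} {a A : Tm} {φ : EqProp} (h : Typing S Γ a A)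
    (hΓ : CtxOk S (.co φ :: Γ)) : Typing S (.co φ :: Γ) a A := by
  simpa only [Tm.subst_var] using
    h.transport IsRenaming.morphismClass (hΓ.isRenaming_co succ_mem_coDom_co)

theorem DefEq.weaken_co {Γ : Ctx} {Δ Δ' : Finset ℕ} {a b A : Tm} {R : Role} {φ : EqProp}
    (h : DefEq S Γ Δ a b A R) (hΓ : CtxOk S (.co φ :: Γ)) (hΔ : ∀ c, c ∈ Δ → c + 1 ∈ Δ') :
    DefEq S (.co φ :: Γ) Δ' a b A R := by
  simpa only [Tm.subst_var] using
    h.transport IsRenaming.morphismClass (hΓ.isRenaming_co succ_mem_coDom_co)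
      (hΓ.isRenaming_co hΔ)

theorem Typing.weaken_nil {Γ : Ctx} {A B : Tm} (h : Typing S [] A B) (hΓ : CtxOk S Γ) :
    Typing S Γ A B := by
  rw [← A.subst_var, ← B.subst_var]
  exact h.transport IsRenaming.morphismClass
    ⟨hΓ, ⟨id, rfl, fun _ _ h => by cases h⟩, fun _ _ h => by cases h⟩

/-- The judgment `Γ ⊨ A : star` survives any well-formed extension of the context by which a variable
of type `A` is still in scope. -/
theorem CtxOk.typing_of_hasTm {Γ : Ctx} {x : ℕ} {A : Tm} (hx : HasTm Γ x A) (hΓ : CtxOk S Γ) :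
    Typing S Γ A .star := by
  induction hx with
  | here =>
    cases hΓ with
    | consTm h hA => exact hA.weaken_tm (.consTm h hA)
  | skipTm _ ih =>
    cases hΓ with
    | consTm h hA => exact (ih h).weaken_tm (.consTm h hA)
  | skipCo _ ih =>
    cases hΓ with
    | consCo h hφ => exact (ih h).weaken_co (.consCo h hφ)

/-! ### Substitution and cut -/

/-- Morphisms of contexts that take variables to well-typed terms and assumptions to provable
equalities. -/
def IsSubstitution (S : Sig) (Γ : Ctx) (Δ : Finset ℕ) (Γ' : Ctx) (Δ' : Finset ℕ) (s : ℕ → Tm) :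
    Prop :=
  CtxOk S Γ' ∧
  (∀ x A, HasTm Γ x A → Typing S Γ' (s x) (A.subst s)) ∧
  ∀ c φ, HasCo Γ c φ → c ∈ Δ →
    DefEq S Γ' Δ' (φ.lhs.subst s) (φ.rhs.subst s) (φ.ty.subst s) φ.role

theorem IsSubstitution.morphismClass : MorphismClass S (IsSubstitution S) where
  ctxOk m := m.1
  var m hx := m.2.1 _ _ hx
  assn m hc hΔ := m.2.2 _ _ hc hΔ
  consTm := by
    rintro Γ Δ Γ' Δ' s A ⟨hΓ, htm, hco⟩ hA
    have hΓ' := CtxOk.consTm hΓ hA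
    refine ⟨hΓ', ?_, ?_⟩
    · rintro x B (_ | hx)
      · rw [Tm.shift_subst]
        exact .var hΓ' .here
      · rw [Tm.shift_subst]
        exact (htm _ _ hx).weaken_tm hΓ'
    · rintro c φ (_ | hc) hΔ
      simp only [EqProp.shift, Tm.shift_subst]
      exact (hco _ _ hc hΔ).weaken_tm hΓ'
  consCo := by
    rintro Γ Δ Γ' Δ' s φ ⟨hΓ, htm, hco⟩ hφ
    have hΓ' := CtxOk.consCo hΓ hφ
    refine ⟨hΓ', ?_, ?_⟩
    · rintro x B (_ | _ | hx)
      exact (htm _ _ hx).weaken_co hΓ'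
    · rintro c ψ (_ | _ | hc) hΔ
      · exact absurd hΔ (zero_notMem_shiftCo Δ)
      · exact (hco _ _ hc (succ_mem_shiftCo.1 hΔ)).weaken_co hΓ' fun _ => succ_mem_shiftCo.2
  consCoDom := by
    rintro Γ Γ' s φ ⟨hΓ, htm, hco⟩ hφ
    have hΓ' := CtxOk.consCo hΓ hφ
    refine ⟨hΓ', ?_, ?_⟩
    · rintro x B (_ | _ | hx)
      exact (htm _ _ hx).weaken_co hΓ'
    · rintro c ψ (_ | _ | hc) -
      · exact .assn hΓ' .here HasCo.here.mem_coDom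
      · exact (hco _ _ hc hc.mem_coDom).weaken_co hΓ' succ_mem_coDom_co

theorem Typing.inst {Γ : Ctx} {a A B C : Tm} (hB : Typing S (.tm A :: Γ) B C)
    (ha : Typing S Γ a A) : Typing S Γ (B.inst a) (C.inst a) := by
  have hΓ := ha.ctxOk
  refine hB.transport IsSubstitution.morphismClass ⟨hΓ, ?_, ?_⟩
  · rintro x D (_ | hx)
    · change Typing S Γ a (A.shift.inst a)
      rwa [Tm.shift_inst]
    · change Typing S Γ (.var _) (Tm.inst (Tm.shift _) a)
      rw [Tm.shift_inst]
      exact .var hΓ hx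
  · rintro c φ (_ | @⟨_, _, φ, _, hc⟩) hΔ
    change DefEq S Γ _ (φ.lhs.shift.inst a) (φ.rhs.shift.inst a) (φ.ty.shift.inst a) φ.role
    rw [Tm.shift_inst, Tm.shift_inst, Tm.shift_inst]
    exact .assn hΓ hc hΔ

/-- A coercion assumption that is provable may be discharged; terms do not mention coercion
variables, so neither the term nor its type changes. -/
theorem Typing.cut {Γ : Ctx} {a b A B C : Tm} {R : Role}
    (hB : Typing S (.co ⟨a, b, A, R⟩ :: Γ) B C) (h : DefEq S Γ (coDom Γ) a b A R)
    (hΓ : CtxOk S Γ) : Typing S Γ B C := by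
  rw [← B.subst_var, ← C.subst_var]
  refine hB.transport IsSubstitution.morphismClass ⟨hΓ, ?_, ?_⟩
  · rintro x D (_ | _ | hx)
    exact D.subst_var.symm ▸ .var hΓ hx
  · rintro c φ (_ | _ | hc) -
    · simpa only [Tm.subst_var] using h
    · simpa only [Tm.subst_var] using DefEq.assn hΓ hc hc.mem_coDom

/-! ### Inversion and regularity -/

theorem Typing.pi_inv {Γ : Ctx} {r : Rel} {A B T : Tm} (h : Typing S Γ (.pi r A B) T) :
    Typing S (.tm A :: Γ) B .star :=
  aux h rfl
where
  aux {Γ : Ctx} {t T : Tm} : Typing S Γ t T → t = .pi r A B → Typing S (.tm A :: Γ) B .star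
    | .pi hB _, rfl => hB
    | .conv h _ _, e => aux h e

theorem Typing.all_inv {Γ : Ctx} {a b A B T : Tm} {R : Role}
    (h : Typing S Γ (.all a b A R B) T) : Typing S (.co ⟨a, b, A, R⟩ :: Γ) B .star :=
  aux h rfl
where
  aux {Γ : Ctx} {t T : Tm} :
      Typing S Γ t T → t = .all a b A R B → Typing S (.co ⟨a, b, A, R⟩ :: Γ) B .star
    | .cpi hB _, rfl => hB
    | .conv h _ _, e => aux h e

/-- By induction on the typing derivation. The instances of the codomain in the rules for application
are typed by inversion of the type of the function and substitution, the result of a coercion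
application by cut. The type of a case expression is the type of its default branch. -/
theorem Typing.regularity {Γ : Ctx} {a A : Tm} : Typing S Γ a A → Typing S Γ A .star
  | .star hΓ => .star hΓ
  | .var hΓ hx => hΓ.typing_of_hasTm hx
  | .pi _ hA => .star hA.ctxOk
  | .abs hb hA _ => .pi hb.regularity hA
  | .app hb ha => hb.regularity.pi_inv.inst ha
  | .tapp hb ha _ => hb.regularity.pi_inv.inst ha
  | .iapp hb ha => hb.regularity.pi_inv.inst ha
  | .conv _ _ hB => hB
  | .cpi _ hφ => .star hφ.ctxOk
  | .cabs ha hφ => .cpi ha.regularity hφ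
  | .capp ha he => ha.regularity.all_inv.cut he ha.ctxOk
  | .const hΓ _ hA => hA.weaken_nil hΓ
  | .fam hΓ _ hA => hA.weaken_nil hΓ
  | .caseOf _ _ _ h₂ _ _ => h₂.regularity

end SystemDR

theorem mainTheorem8 (S : SystemDR.Sig) (hS : SystemDR.WfSig S)
    (Γ : SystemDR.Ctx) (a A : SystemDR.Tm) (h : SystemDR.Typing S Γ a A) :
    SystemDR.Typing S Γ A SystemDR.Tm.star :=
  h.regularity
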